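/- Let $M$ be a compact connected smooth Riemannian manifold of dimension $d$, with distance induced by the metric and Lebesgue (Riemannian volume) measure $\lambda$. Let $g_1,\dots,g_m:M\to M$ be conformal local diffeomorphisms (in particular, possibly, diffeomorphisms) of class $C^{1+\alpha}$, $0<\alpha\le 1$, where conformal means that $Dg(x)=a(x)\,\mathrm{Isom}(x)$ with a scalar $a(x)$ and a linear isometry $\mathrm{Isom}(x):T_xM\to T_{g(x)}M$. Let $\Gamma$ be the semigroup (with identity) generated by them under composition, and assume that $\Gamma$ is locally expanding: for every $x\in M$ there is $h\in\Gamma$ with $\|Dh(x)^{-1}\|^{-1}>1$. Let $f_1,\dots,f_k\in\Gamma$, open balls $V_1,\dots,V_k$ covering $M$, and constants $\sigma<1$, $r>0$ be such that, on the $r$-neighbourhood of $V_i$, the map $f_i$ is a diffeomorphism onto its image and $\|Df_i(x)^{-1}\|<\sigma$; let $0<\eta<r/2$ be a Lebesgue number of $\{V_1,\dots,V_k\}$ (every set of diameter less than $\eta$ lies in some $V_i$). For a nonempty word $w=(i_1,\dots,i_n)$ put $f_w^j=f_{i_j}\circ\cdots\circ f_{i_1}$, $0\le j\le n$; $w$ is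 admissible for $x$ if $f_w^{j}(x)\in V_{i_{j+1}}$ for $0\le j<n$. The dynamical ball is $B(x,n+1,w,\varepsilon)=\{y: d(f_w^j(x),f_w^j(y))<\varepsilon,\ 0\le j\le n\}$. Assume that $\Gamma$ is topologically mixing: for all nonempty open sets $U,V\subset M$ of diameter less than $\eta/2$ there are a point $x$, a word $w$ admissible for $x$ and $0<\rho<\eta$ such that $V\subset B(f_w^n(x),\rho)$ and $B(x,n+1,w,\rho)\subset U$. Then for every $\delta>0$ there are $0<\varepsilon<\delta$ with $\varepsilon\le\eta/6$ and a finite cover of $M$ by distinct open balls $B_j=B(p_j,\varepsilon)$, $j=1,\dots,N$, and a countable family $(M_i,h_i)_{i\in I}$ of nonempty closed sets $M_i\subset M$ and maps $h_i\in\Gamma$ such that the following hold. 1. $(M_i,h_i)$ is a countable Markov partition for $\Gamma$: $\lambda(M\setminus\bigcup_i M_i)=0$; $M_i=\mathrm{Cl}(\mathrm{int}\,M_i)$; $\mathrm{int}\,M_i\cap\mathrm{int}\,M_{i'}=\emptyset$ for $i\ne i'$; and $h_i(M_i)\supset M_{i'}$ whenever $\mathrm{int}\,M_i\cap h_i^{-1}(\mathrm{int}\,M_{i'})\ne\emptyset$.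 2. Finite images property: $\{h_i(\mathrm{int}\,M_i): i\in I\}$ is a finite collection of open sets. 3. Finite cycle property: if $N'$ is the number of sets in that collection, there are $n_1,\dots,n_{N'}\in I$ such that for every $\ell\in I$ there are $i,j$ with $h_{n_i}(M_{n_i})\supset M_\ell$ and $h_\ell(M_\ell)\supset M_{n_j}$. 4. The sets $M_i$ are pairwise disjoint closed dynamical balls pulled back from the cover: for every $i$ there are $j$ and a word $w$, of length $n$, with $h_i=f_w^n$, $h_i(\mathrm{int}\,M_i)=B_j$ and $M_i=\mathrm{Cl}\,B(y,n+1,w,\varepsilon)$, where $f_w^n(y)=p_j$ and, for some $x$ for which $w$ is admissible and some $0<\rho<\eta$, $B_j\subset B(f_w^n(x),\rho)$ and $y\in B(x,n+1,w,\rho)$. Moreover each $M_i$ is contained in some $B_j$. 5. There are $b_1,\dots,b_N\in I$ with $M_{b_j}\subset B_j$ and $h_{b_j}(\mathrm{int}\,M_{b_j})=B_{j+1}$ for all $j$, where $B_{N+1}=B_1$. -/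

import Mathlib

open Set Topology Manifold Bundle
open scoped NNReal ContDiff

noncomputable section

namespace LocExp

/-! ### Words and semigroups of self-maps -/

section Words

variable {M : Type*} {k : ℕ}

/-- The map `f_w = f_{i_n} ∘ ⋯ ∘ f_{i_1}` of the word `w = (i_1, …, i_n)`;
the empty word gives the identity. -/
def wordMap (f : Fin k → M → M) : List (Fin k) → M → M
  | [] => id
  | i :: w => wordMap f w ∘ f i

/-- The semigroup (with identity) generated under composition by finitely many maps. -/
def semigroupGenerated (g : Fin k → M → M) : Set (M → M) :=
  {h | ∃ w : List (Fin k), h = wordMap g w}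

/-- The dynamical `(n+1)`-ball `B(x, n+1, w, ε)` along the word `w = (i_1, …, i_n)`: the points
whose orbit along `w` stays `ε`-close to that of `x` at all times `0, …, n`. -/
def dynBall [MetricSpace M] (f : Fin k → M → M) (x : M) (w : List (Fin k)) (ε : ℝ) : Set M :=
  {y | ∀ j ≤ w.length, dist (wordMap f (w.take j) x) (wordMap f (w.take j) y) < ε}

end Words

/-! ### Smoothness, conformality, expansion and null sets -/

section Manifolds

variable {d : ℕ} {M : Type*} [MetricSpace M] [ChartedSpace (EuclideanSpace ℝ (Fin d)) M]

/-- `g` is of class `C^{1+α}`: it is `C^1`, and in charts its derivative is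
locally `α`-Hölder. -/
def IsC1Holder (d : ℕ) {M : Type*} [MetricSpace M] [ChartedSpace (EuclideanSpace ℝ (Fin d)) M]
    (α : ℝ≥0) (g : M → M) : Prop :=
  ContMDiff (𝓡 d) (𝓡 d) 1 g ∧
    ∀ x : M, ∃ C : ℝ≥0, ∃ s ∈ 𝓝 (extChartAt (𝓡 d) x x),
      HolderOnWith C α (fderiv ℝ (writtenInExtChartAt (𝓡 d) (𝓡 d) x g)) s

/-- `A` is a null set for the Lebesgue (Riemannian volume) measure class of the manifold:
its image in every chart has Lebesgue measure zero. -/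
def IsLebesgueNull (d : ℕ) {M : Type*} [MetricSpace M]
    [ChartedSpace (EuclideanSpace ℝ (Fin d)) M] (A : Set M) : Prop :=
  ∀ x : M, MeasureTheory.volume
    (extChartAt (𝓡 d) x '' (A ∩ (extChartAt (𝓡 d) x).source)) = 0

variable [IsManifold (𝓡 d) ∞ M] [RiemannianBundle (fun x : M ↦ TangentSpace (𝓡 d) x)]

/-- `g` is conformal: `Dg(x) = a(x) Isom(x)` for a real function `a` and linear isometries
`Isom(x) : T_x M → T_{g x} M`. -/
def IsConformal (d : ℕ) {M : Type*} [MetricSpace M] [ChartedSpace (EuclideanSpace ℝ (Fin d)) M]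
    [IsManifold (𝓡 d) ∞ M] [RiemannianBundle (fun x : M ↦ TangentSpace (𝓡 d) x)]
    (g : M → M) : Prop :=
  ∃ a : M → ℝ, ∀ x : M,
    ∃ L : TangentSpace (𝓡 d) x ≃ₗᵢ[ℝ] TangentSpace (𝓡 d) (g x),
      ∀ v : TangentSpace (𝓡 d) x, mfderiv (𝓡 d) (𝓡 d) g x v = a x • L v

/-- The norm `‖Dg(x)⁻¹‖` in the Riemannian metric. -/
def invDerivNorm (d : ℕ) {M : Type*} [MetricSpace M]
    [ChartedSpace (EuclideanSpace ℝ (Fin d)) M]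
    [IsManifold (𝓡 d) ∞ M] [RiemannianBundle (fun x : M ↦ TangentSpace (𝓡 d) x)]
    (g : M → M) (x : M) : ℝ :=
  ‖(mfderiv (𝓡 d) (𝓡 d) g x).inverse‖

/-- The semigroup `Γ` is locally expanding: at every point `x` some `h ∈ Γ` has co-norm
`m(Dh(x)) = ‖Dh(x)⁻¹‖⁻¹ > 1`. -/
def LocallyExpanding (d : ℕ) {M : Type*} [MetricSpace M]
    [ChartedSpace (EuclideanSpace ℝ (Fin d)) M]
    [IsManifold (𝓡 d) ∞ M] [RiemannianBundle (fun x : M ↦ TangentSpace (𝓡 d) x)]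
    (Γ : Set (M → M)) : Prop :=
  ∀ x : M, ∃ h ∈ Γ, 1 < (invDerivNorm d h x)⁻¹

/-- The choices attached to a locally expanding semigroup: finitely many maps `f_i ∈ Γ` and open
balls `V_i` covering `M`, and constants `σ < 1`, `r > 0`, such that `f_i` restricted to the
`r`-neighbourhood of `V_i` is a diffeomorphism onto its image with `‖Df_i⁻¹‖ < σ`; moreover a
Lebesgue number `η < r / 2` of the cover. -/
structure ExpandingCover (d : ℕ) {M : Type*} [MetricSpace M]
    [ChartedSpace (EuclideanSpace ℝ (Fin d)) M]
    [IsManifold (𝓡 d) ∞ M] [RiemannianBundle (fun x : M ↦ TangentSpace (𝓡 d) x)]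
    (Γ : Set (M → M)) where
  /-- number of maps -/
  k : ℕ
  /-- the maps -/
  f : Fin k → M → M
  /-- the open sets -/
  V : Fin k → Set M
  /-- contraction rate of the inverse branches -/
  σ : ℝ
  /-- size of the neighbourhoods -/
  r : ℝ
  /-- Lebesgue number -/
  η : ℝ
  f_mem : ∀ i, f i ∈ Γ
  isBall : ∀ i, ∃ c : M, ∃ ρ > 0, V i = Metric.ball c ρ
  cover : ⋃ i, V i = univ
  σ_lt_one : σ < 1
  r_pos : 0 < r
  isLocalDiffeomorphAt : ∀ i, ∀ x ∈ Metric.thickening r (V i),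
    IsLocalDiffeomorphAt (𝓡 d) (𝓡 d) 1 (f i) x
  injOn : ∀ i, InjOn (f i) (Metric.thickening r (V i))
  expanding : ∀ i, ∀ x ∈ Metric.thickening r (V i), invDerivNorm d (f i) x < σ
  η_pos : 0 < η
  η_lt : η < r / 2
  lebesgue : ∀ A : Set M, Metric.diam A < η → ∃ i, A ⊆ V i

variable {Γ : Set (M → M)}

/-- The (nonempty) word `w = (i_1, …, i_n)` is admissible for `x`: `x ∈ V_{i_1}` and
`f_{i_j} ∘ ⋯ ∘ f_{i_1} (x) ∈ V_{i_{j+1}}` for `1 ≤ j < n`. -/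
def ExpandingCover.Admissible (D : ExpandingCover d Γ) (w : List (Fin D.k)) (x : M) : Prop :=
  w ≠ [] ∧ ∀ (j : ℕ) (hj : j < w.length), wordMap D.f (w.take j) x ∈ D.V w[j]

/-- `Γ` is topologically mixing: for all small (nonempty) open sets `U`, `V` there are an
admissible word `w` of a point `x` and a ball `B` of radius `ρ < η` around `f_w(x)` such that
`V ⊆ B`, and the admissible cylinder `f_w^{-n}(B)`, i.e. the dynamical ball of `x` along `w` that
`f_w` maps onto `B`, is contained in `U`. -/
def ExpandingCover.TopologicallyMixing (D : ExpandingCover d Γ) : Prop :=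
  ∀ U V : Set M, IsOpen U → IsOpen V → U.Nonempty → V.Nonempty →
    Metric.diam U < D.η / 2 → Metric.diam V < D.η / 2 →
      ∃ (x : M) (w : List (Fin D.k)) (ρ : ℝ), D.Admissible w x ∧ 0 < ρ ∧ ρ < D.η ∧
        V ⊆ Metric.ball (wordMap D.f w x) ρ ∧ dynBall D.f x w ρ ⊆ U

/-- `K` is a closed dynamical ball obtained by pulling the ball `B(p, ε)` back along the word `w`:
`B(p, ε)` lies in a ball `B(f_w(x), ρ)`, `ρ < η`, whose inverse branch along a word `w` admissible
for `x` is defined, and `K` is the closure of the dynamical `ε`-ball along `w` around the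
preimage `y` of `p` under this branch. -/
def ExpandingCover.IsClosedDynBall (D : ExpandingCover d Γ) (p : M) (ε : ℝ) (w : List (Fin D.k))
    (K : Set M) : Prop :=
  ∃ (x : M) (ρ : ℝ) (y : M), D.Admissible w x ∧ 0 < ρ ∧ ρ < D.η ∧
    Metric.ball p ε ⊆ Metric.ball (wordMap D.f w x) ρ ∧
    y ∈ dynBall D.f x w ρ ∧ wordMap D.f w y = p ∧ K = closure (dynBall D.f y w ε)

end Manifolds

/-! ### Countable Markov partitions -/

section Markov

variable {M : Type*} [MetricSpace M] {ι : Type*}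

/-- `(P_i, h_i)` is a countable Markov partition for the semigroup `Γ`. -/
structure IsMarkovPartition (d : ℕ) {M : Type*} [MetricSpace M]
    [ChartedSpace (EuclideanSpace ℝ (Fin d)) M] {ι : Type*}
    (Γ : Set (M → M)) (P : ι → Set M) (h : ι → M → M) : Prop where
  countable : Countable ι
  mem : ∀ i, h i ∈ Γ
  isClosed : ∀ i, IsClosed (P i)
  nonempty : ∀ i, (P i).Nonempty
  null_compl : IsLebesgueNull d (univ \ ⋃ i, P i)
  eq_closure : ∀ i, P i = closure (interior (P i))
  disjoint : ∀ i j, i ≠ j → interior (P i) ∩ interior (P j) = ∅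
  markov : ∀ i j, (interior (P i) ∩ h i ⁻¹' interior (P j)).Nonempty → P j ⊆ h i '' P i

/-- The collection `{h_i(int P_i)}` of images. -/
def images (P : ι → Set M) (h : ι → M → M) : Set (Set M) :=
  range fun i ↦ h i '' interior (P i)

/-- The finite images property: the images are finitely many open sets `B_1, …, B_N`. -/
def FiniteImages (P : ι → Set M) (h : ι → M → M) : Prop :=
  (images P h).Finite ∧ ∀ B ∈ images P h, IsOpen B

/-- The finite cycle property: there are indices `n_1, …, n_N` (as many as there are images) such
that for every `l` there are `i, j` with `h_{n_i}(P_{n_i}) ⊇ P_l` and `h_l(P_l) ⊇ P_{n_j}`. -/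
def FiniteCycle (P : ι → Set M) (h : ι → M → M) : Prop :=
  ∃ n : Fin (images P h).ncard → ι, ∀ l, ∃ i j,
    P l ⊆ h (n i) '' P (n i) ∧ P (n j) ⊆ h l '' P l

end Markov

end LocExp

end

/-! Each partition element is a dynamical ball, the pullback of a ball `B_j` of a finite cover along
an admissible word. Along such a word every inverse branch contracts by `σ`, so distances between
nearby orbits are largest at the last time and the word maps the dynamical `ε`-ball onto a true
`ε`-ball (`ExpandingMaps.image_dynBall`).

Conformality and `C^{1+α}` regularity control the shape of these sets. The logarithm of the
conformal factor is Hölder (`IsC1Holder.holderNear_log`); its oscillations along two nearby orbits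
form a geometric series, so the factor of a word varies by at most a constant `K` on a dynamical
ball (`exists_distortion`). The dynamical ball then lies between concentric balls whose radii have
ratio `K ^ 2` (`dynBall_eccentricity`). The Hausdorff measure `μH[d]`, which dominates Lebesgue
measure in charts, is doubling, so pieces fill a definite proportion of comparable balls. Long words
give such pieces around every point at every scale (`exists_small_isPiece`), and Vitali's theorem
selects countably many disjoint ones covering almost everything.

The radius `ε` is generic: the spheres of the cover are null, and each ball is the interior of its
closure. Off the spheres, small pieces can be kept inside or disjoint from each `B_j` (`Adapted`).
As the image of the interior of a piece is some `B_j`, this dichotomy is exactly the Markov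
property.

Mixing gives the cycle: disjoint pieces placed beforehand in the `B_t` and mapped onto `B_{t+1}`
(`exists_cycle`). They are closed, so Vitali's theorem can be run in their complement. The cycle
makes every `B_j` an image and yields the finite cycle property. -/

noncomputable section

namespace LocExp

/-! ### Paths and Lipschitz estimates on Riemannian manifolds -/

section RiemannianPaths

open scoped ENNReal

variable {E : Type*} [NormedAddCommGroup E] [NormedSpace ℝ E] {H : Type*} [TopologicalSpace H]
  {I : ModelWithCorners ℝ E H} {M : Type*} [MetricSpace M] [ChartedSpace H M]
  [RiemannianBundle (fun x : M ↦ TangentSpace I x)] [IsRiemannianManifold I M]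
  {F : Type*} [NormedAddCommGroup F] [NormedSpace ℝ F] {H' : Type*} [TopologicalSpace H']
  {J : ModelWithCorners ℝ F H'} {N : Type*} [MetricSpace N] [ChartedSpace H' N]
  [RiemannianBundle (fun x : N ↦ TangentSpace J x)] [IsRiemannianManifold J N]

/-- A `C^1` path of length less than `ℓ` joining two points at distance less than `ℓ`. -/
lemma exists_path_of_dist_lt {x y : M} {ℓ : ℝ} (h : dist x y < ℓ) :
    ∃ γ : ℝ → M, γ 0 = x ∧ γ 1 = y ∧ ContMDiff 𝓘(ℝ) I 1 γ ∧
      pathELength I γ 0 1 < ENNReal.ofReal ℓ := by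
  have h1 : riemannianEDist I x y < ENNReal.ofReal ℓ := by
    rw [← IsRiemannianManifold.out (I := I) x y, edist_dist]
    exact (ENNReal.ofReal_lt_ofReal_iff (dist_nonneg.trans_lt h)).2 h
  obtain ⟨γ, h0, h1, hγ, hl, -⟩ :=
    exists_lt_locally_constant_of_riemannianEDist_lt h1 zero_lt_one
  exact ⟨γ, h0, h1, hγ, hl⟩

lemma edist_le_pathELength {γ : ℝ → M} {a b : ℝ} (hab : a ≤ b)
    (hγ : ContMDiffOn 𝓘(ℝ) I 1 γ (Icc a b)) :
    edist (γ a) (γ b) ≤ pathELength I γ a b := by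
  rw [IsRiemannianManifold.out (I := I)]
  exact riemannianEDist_le_pathELength hγ rfl rfl hab

omit [IsRiemannianManifold I M] in
/-- The image of a path under a map with derivative bounded by `C` moves by at most `C` times the
length of the path. -/
lemma edist_comp_path_le {h : M → N} {W : Set M} (hW : IsOpen W)
    (hh : ContMDiffOn I J 1 h W) {C : ℝ≥0}
    (hC : ∀ y ∈ W, ∀ v : TangentSpace I y, ‖mfderiv I J h y v‖ₑ ≤ C * ‖v‖ₑ)
    {γ : ℝ → M} (hγ : ContMDiff 𝓘(ℝ) I 1 γ) {t : ℝ} (ht : 0 ≤ t)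
    (hmem : ∀ s ∈ Icc 0 t, γ s ∈ W) :
    edist (h (γ 0)) (h (γ t)) ≤ C * pathELength I γ 0 t := by
  rcases ht.eq_or_lt with rfl | ht'
  · simp
  have hcomp : ContMDiffOn 𝓘(ℝ) J 1 (h ∘ γ) (Icc 0 t) := hh.comp hγ.contMDiffOn hmem
  refine (edist_le_pathELength (I := J) (γ := h ∘ γ) ht hcomp).trans ?_
  rw [pathELength_eq_lintegral_mfderivWithin_Icc, pathELength_eq_lintegral_mfderivWithin_Icc,
    ← MeasureTheory.lintegral_const_mul' _ _ ENNReal.coe_ne_top]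
  refine MeasureTheory.setLIntegral_mono' measurableSet_Icc fun s hs ↦ ?_
  have hd : mfderivWithin 𝓘(ℝ) J (h ∘ γ) (Icc 0 t) s =
      (mfderiv I J h (γ s)) ∘L (mfderivWithin 𝓘(ℝ) I γ (Icc 0 t) s) := by
    apply mfderiv_comp_mfderivWithin
    · exact ((hh _ (hmem s hs)).contMDiffAt (hW.mem_nhds (hmem s hs))).mdifferentiableAt
        one_ne_zero
    · exact (hγ.mdifferentiable one_ne_zero).mdifferentiableOn _ hs
    · rw [uniqueMDiffWithinAt_iff_uniqueDiffWithinAt]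
      exact uniqueDiffOn_Icc ht' _ hs
  rw [hd]
  exact hC _ (hmem s hs) _

/-- A map with derivative bounded by `C` on a ball contracts distances to the centre up to the
factor `C`. -/
lemma dist_le_of_ball_subset {h : M → N} {W : Set M} (hW : IsOpen W)
    (hh : ContMDiffOn I J 1 h W) {C : ℝ≥0}
    (hC : ∀ y ∈ W, ∀ v : TangentSpace I y, ‖mfderiv I J h y v‖ₑ ≤ C * ‖v‖ₑ)
    {q z : M} {R : ℝ} (hR : Metric.ball q R ⊆ W) (hz : z ∈ Metric.ball q R) :
    dist (h q) (h z) ≤ C * dist q z := by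
  rw [Metric.mem_ball'] at hz
  have key : ∀ ℓ ∈ Ioo (dist q z) R, dist (h q) (h z) ≤ C * ℓ := by
    intro ℓ hℓ
    obtain ⟨γ, h0, h1, hγ, hl⟩ := exists_path_of_dist_lt (I := I) hℓ.1
    -- A path from `q` of length less than `R` cannot leave `B(q, R)`, so no convexity of the ball
    -- is needed.
    have hmem : ∀ s ∈ Icc (0 : ℝ) 1, γ s ∈ W := by
      intro s hs
      apply hR
      have : edist (γ 0) (γ s) < ENNReal.ofReal ℓ :=
        (edist_le_pathELength (I := I) hs.1 hγ.contMDiffOn).trans_lt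
          ((pathELength_mono le_rfl hs.2).trans_lt hl)
      rw [edist_dist, h0, ENNReal.ofReal_lt_ofReal_iff (dist_nonneg.trans_lt hℓ.1)] at this
      exact Metric.mem_ball'.2 (this.trans hℓ.2)
    have h2 := (edist_comp_path_le hW hh hC hγ zero_le_one hmem).trans
      (mul_le_mul_right hl.le _)
    rw [h0, h1, edist_dist, ← ENNReal.ofReal_coe_nnreal,
      ← ENNReal.ofReal_mul C.coe_nonneg,
      ENNReal.ofReal_le_ofReal_iff (mul_nonneg C.coe_nonneg (dist_nonneg.trans hℓ.1.le))] at h2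
    exact h2
  have hmem : dist q z ∈ closure (Ioo (dist q z) R) := by
    rw [closure_Ioo hz.ne]; exact left_mem_Icc.2 hz.le
  have hcl : IsClosed {ℓ : ℝ | dist (h q) (h z) ≤ C * ℓ} :=
    isClosed_le continuous_const (by fun_prop)
  exact closure_minimal key hcl hmem

/-- Two points of `B(x, r)` are less than `2r` apart, and the `2r`-ball around either lies in `B(x,
3r)`; hence the factor `3`. -/
lemma lipschitzOnWith_ball_of_mfderiv_le {h : M → N} {x : M} {r : ℝ}
    (hh : ContMDiffOn I J 1 h (Metric.ball x (3 * r))) {C : ℝ≥0}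
    (hC : ∀ y ∈ Metric.ball x (3 * r), ∀ v : TangentSpace I y,
      ‖mfderiv I J h y v‖ₑ ≤ C * ‖v‖ₑ) :
    LipschitzOnWith C h (Metric.ball x r) := by
  refine LipschitzOnWith.of_dist_le_mul fun y hy z hz ↦ ?_
  rw [Metric.mem_ball] at hy hz
  refine dist_le_of_ball_subset (R := 2 * r) Metric.isOpen_ball hh hC (fun u hu ↦ ?_) ?_
  · rw [Metric.mem_ball] at hu ⊢
    linarith [dist_triangle u y x]
  · rw [Metric.mem_ball]
    linarith [dist_triangle_right z y x]

end RiemannianPaths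

/-! ### Charts and `C^1` maps are locally Lipschitz for the Riemannian distance. -/

section Charts

variable {d : ℕ} {M : Type*} [MetricSpace M] [ChartedSpace (EuclideanSpace ℝ (Fin d)) M]
  [IsManifold (𝓡 d) ∞ M] [RiemannianBundle (fun x : M ↦ TangentSpace (𝓡 d) x)]
  [IsContMDiffRiemannianBundle (𝓡 d) ∞ (EuclideanSpace ℝ (Fin d))
    (fun x : M ↦ TangentSpace (𝓡 d) x)]
  [IsRiemannianManifold (𝓡 d) M]

lemma isContinuousRiemannianBundle_tangentSpace (d : ℕ) (M : Type*) [MetricSpace M]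
    [ChartedSpace (EuclideanSpace ℝ (Fin d)) M]
    [IsManifold (𝓡 d) ∞ M] [RiemannianBundle (fun x : M ↦ TangentSpace (𝓡 d) x)]
    [IsContMDiffRiemannianBundle (𝓡 d) ∞ (EuclideanSpace ℝ (Fin d))
      (fun x : M ↦ TangentSpace (𝓡 d) x)] :
    IsContinuousRiemannianBundle (EuclideanSpace ℝ (Fin d))
      (fun x : M ↦ TangentSpace (𝓡 d) x) := by
  obtain ⟨g, hg, h⟩ := IsContMDiffRiemannianBundle.exists_contMDiff (IB := 𝓡 d) (n := ∞)
    (F := EuclideanSpace ℝ (Fin d)) (E := fun x : M ↦ TangentSpace (𝓡 d) x)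
  exact ⟨g, hg.continuous, h⟩

section VectorSpaceNorm

attribute [local instance] normedAddCommGroupTangentSpaceVectorSpace
attribute [local instance] normedSpaceTangentSpaceVectorSpace

omit [IsRiemannianManifold (𝓡 d) M] in
-- The vectorwise form, with the Euclidean norm forced by `show`, can be used where the local norm
-- instances on tangent spaces of a vector space are not active.
lemma eventually_enorm_mfderiv_extChartAt_apply_le (x : M) :
    ∃ C : ℝ≥0, ∀ᶠ y in 𝓝 x, ∀ v : TangentSpace (𝓡 d) y,
      ‖(show EuclideanSpace ℝ (Fin d) from mfderiv (𝓡 d) (𝓡 d) (extChartAt (𝓡 d) x) y v)‖ₑ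
        ≤ C * ‖v‖ₑ := by
  have := isContinuousRiemannianBundle_tangentSpace d M
  obtain ⟨C, hC0, hC⟩ := eventually_enorm_mfderiv_extChartAt_lt (𝓡 d) x
  refine ⟨C, ?_⟩
  filter_upwards [hC] with y hy v
  exact (ContinuousLinearMap.le_opENorm _ v).trans (mul_le_mul_left hy.le _)

omit [IsRiemannianManifold (𝓡 d) M] in
lemma eventually_enorm_mfderiv_extChartAt_symm_apply_le (x : M) :
    ∃ C : ℝ≥0, ∀ᶠ y in 𝓝 (extChartAt (𝓡 d) x x), ∀ v : TangentSpace (𝓡 d) y,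
      ‖mfderiv (𝓡 d) (𝓡 d) (extChartAt (𝓡 d) x).symm y v‖ₑ
        ≤ C * ‖(show EuclideanSpace ℝ (Fin d) from v)‖ₑ := by
  have := isContinuousRiemannianBundle_tangentSpace d M
  obtain ⟨C, hC0, hC⟩ := eventually_enorm_mfderivWithin_symm_extChartAt_lt (𝓡 d) x
  refine ⟨C, ?_⟩
  rw [ModelWithCorners.range_eq_univ, nhdsWithin_univ] at hC
  filter_upwards [hC] with y hy v
  rw [mfderivWithin_univ] at hy
  exact (ContinuousLinearMap.le_opENorm _ v).trans (mul_le_mul_left hy.le _)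

end VectorSpaceNorm

lemma exists_lipschitzOnWith_extChartAt (x : M) :
    ∃ C : ℝ≥0, ∃ s ∈ 𝓝 x, LipschitzOnWith C (extChartAt (𝓡 d) x) s := by
  obtain ⟨C, hC⟩ := eventually_enorm_mfderiv_extChartAt_apply_le (d := d) x
  obtain ⟨r, hr, hrs⟩ := Metric.mem_nhds_iff.1
    (Filter.inter_mem hC (extChartAt_source_mem_nhds (I := 𝓡 d) x))
  refine ⟨C, Metric.ball x (r / 3), Metric.ball_mem_nhds _ (by positivity), ?_⟩
  have h3 : 3 * (r / 3) = r := by ring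
  refine lipschitzOnWith_ball_of_mfderiv_le (I := 𝓡 d) (J := 𝓡 d) ?_ ?_
  · rw [h3]
    exact (contMDiffOn_extChartAt (I := 𝓡 d) (x := x) (n := 1)).mono
      fun y hy ↦ by simpa using (hrs hy).2
  · rw [h3]
    intro y hy v
    rw [enorm_tangentSpace_vectorSpace]
    exact (hrs hy).1 v

lemma exists_lipschitzOnWith_extChartAt_symm (x : M) :
    ∃ C : ℝ≥0, ∃ s ∈ 𝓝 (extChartAt (𝓡 d) x x),
      LipschitzOnWith C (extChartAt (𝓡 d) x).symm s := by
  obtain ⟨C, hC⟩ := eventually_enorm_mfderiv_extChartAt_symm_apply_le (d := d) x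
  obtain ⟨r, hr, hrs⟩ := Metric.mem_nhds_iff.1
    (Filter.inter_mem hC (extChartAt_target_mem_nhds (I := 𝓡 d) x))
  refine ⟨C, Metric.ball _ (r / 3), Metric.ball_mem_nhds _ (by positivity), ?_⟩
  have h3 : 3 * (r / 3) = r := by ring
  refine lipschitzOnWith_ball_of_mfderiv_le (I := 𝓡 d) (J := 𝓡 d) ?_ ?_
  · rw [h3]
    exact (contMDiffOn_extChartAt_symm (I := 𝓡 d) (n := 1) x).mono fun y hy ↦ (hrs hy).2
  · rw [h3]
    intro y hy v
    rw [enorm_tangentSpace_vectorSpace (v := v)]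
    exact (hrs hy).1 v

/-- A `C^1` map to a normed space is locally Lipschitz. -/
lemma exists_lipschitzOnWith_of_contMDiffAt {F : Type*} [NormedAddCommGroup F] [NormedSpace ℝ F]
    {φ : M → F} {x : M} (hφ : ContMDiffAt (𝓡 d) 𝓘(ℝ, F) 1 φ x) :
    ∃ C : ℝ≥0, ∃ s ∈ 𝓝 x, LipschitzOnWith C φ s := by
  obtain ⟨K, s, hs, hK⟩ := exists_lipschitzOnWith_extChartAt (d := d) x
  have h1 : ContDiffAt ℝ 1 (φ ∘ (extChartAt (𝓡 d) x).symm) (extChartAt (𝓡 d) x x) := by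
    have := (contMDiffAt_iff.1 hφ).2
    rw [ModelWithCorners.range_eq_univ, contDiffWithinAt_univ] at this
    rwa [extChartAt_model_space_eq_id] at this
  obtain ⟨K', t, ht, hK'⟩ := h1.exists_lipschitzOnWith
  refine ⟨K' * K, s ∩ (extChartAt (𝓡 d) x ⁻¹' t ∩ (extChartAt (𝓡 d) x).source),
    Filter.inter_mem hs (Filter.inter_mem ((continuousAt_extChartAt x).preimage_mem_nhds ht)
      (extChartAt_source_mem_nhds x)), ?_⟩
  have := hK'.comp (hK.mono inter_subset_left) (fun y hy ↦ hy.2.1 :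
    MapsTo _ (s ∩ (extChartAt (𝓡 d) x ⁻¹' t ∩ (extChartAt (𝓡 d) x).source)) t)
  intro y hy z hz
  have h := this hy hz
  simp only [Function.comp_apply] at h
  rwa [(extChartAt (𝓡 d) x).left_inv hy.2.2, (extChartAt (𝓡 d) x).left_inv hz.2.2] at h

/-- A `C^1` self-map of a Riemannian manifold is locally Lipschitz. -/
lemma exists_lipschitzOnWith_of_contMDiff {g : M → M} (hg : ContMDiff (𝓡 d) (𝓡 d) 1 g) (x : M) :
    ∃ C : ℝ≥0, ∃ s ∈ 𝓝 x, LipschitzOnWith C g s := by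
  have h1 : ContMDiffAt (𝓡 d) (𝓡 d) 1 (extChartAt (𝓡 d) (g x) ∘ g) x :=
    (contMDiffAt_extChartAt (I := 𝓡 d) (x := g x)).comp x hg.contMDiffAt
  obtain ⟨K, s, hs, hK⟩ := exists_lipschitzOnWith_of_contMDiffAt h1
  obtain ⟨K', t, ht, hK'⟩ := exists_lipschitzOnWith_extChartAt_symm (d := d) (g x)
  have hcont : ContinuousAt (extChartAt (𝓡 d) (g x) ∘ g) x := h1.continuousAt
  refine ⟨K' * K, s ∩ ((extChartAt (𝓡 d) (g x) ∘ g) ⁻¹' t ∩ g ⁻¹' (extChartAt (𝓡 d) (g x)).source),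
    Filter.inter_mem hs (Filter.inter_mem (hcont.preimage_mem_nhds ht)
      (hg.continuous.continuousAt.preimage_mem_nhds (extChartAt_source_mem_nhds _))), ?_⟩
  have := hK'.comp (hK.mono inter_subset_left) (fun y hy ↦ hy.2.1 :
    MapsTo _ (s ∩ ((extChartAt (𝓡 d) (g x) ∘ g) ⁻¹' t ∩
      g ⁻¹' (extChartAt (𝓡 d) (g x)).source)) t)
  intro y hy z hz
  have h := this hy hz
  simp only [Function.comp_apply] at h
  rwa [(extChartAt (𝓡 d) (g x)).left_inv hy.2.2,
    (extChartAt (𝓡 d) (g x)).left_inv hz.2.2] at h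

end Charts

/-! ### A doubling measure in the Lebesgue class -/

/-- A monotone property which holds locally with some constants holds globally with uniform
constants on a compact space. -/
lemma exists_uniform_of_eventually {M : Type*} [TopologicalSpace M] [CompactSpace M]
    {Q : ℝ≥0 → ℝ → M → Prop}
    (mono : ∀ {C C' R R' x}, C ≤ C' → R' ≤ R → Q C R x → Q C' R' x)
    (h : ∀ x, ∃ C, ∃ R > 0, ∀ᶠ y in 𝓝 x, Q C R y) : ∃ C, ∃ R > 0, ∀ x, Q C R x := by
  have := isCompact_univ.induction_on (p := fun s : Set M ↦ ∃ C, ∃ R > 0, ∀ x ∈ s, Q C R x)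
    ⟨0, 1, one_pos, by simp⟩
    (fun s t hst ⟨C, R, hR, h⟩ ↦ ⟨C, R, hR, fun x hx ↦ h x (hst hx)⟩)
    (fun s t ⟨C, R, hR, h⟩ ⟨C', R', hR', h'⟩ ↦ ⟨max C C', min R R', lt_min hR hR', by
      rintro x (hx | hx)
      · exact mono (le_max_left _ _) (min_le_left _ _) (h x hx)
      · exact mono (le_max_right _ _) (min_le_right _ _) (h' x hx)⟩)
    (fun x _ ↦ by
      obtain ⟨C, R, hR, hx⟩ := h x
      exact ⟨_, mem_nhdsWithin_of_mem_nhds hx, C, R, hR, fun y hy ↦ hy⟩)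
  simpa using this

section HausdorffMeasure

open MeasureTheory MeasureTheory.Measure Metric
open scoped ENNReal

variable {d : ℕ} {M : Type*} [MetricSpace M] [ChartedSpace (EuclideanSpace ℝ (Fin d)) M]
  [IsManifold (𝓡 d) ∞ M] [RiemannianBundle (fun x : M ↦ TangentSpace (𝓡 d) x)]
  [IsContMDiffRiemannianBundle (𝓡 d) ∞ (EuclideanSpace ℝ (Fin d))
    (fun x : M ↦ TangentSpace (𝓡 d) x)]
  [IsRiemannianManifold (𝓡 d) M]

/-- Charts are bi-Lipschitz around their base point. -/
lemma exists_biLipschitz_chart (x : M) : ∃ K : ℝ≥0, 1 ≤ K ∧ ∃ r > 0, ∃ s > 0,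
    ball x r ⊆ (extChartAt (𝓡 d) x).source ∧
    ball (extChartAt (𝓡 d) x x) s ⊆ (extChartAt (𝓡 d) x).target ∧
    LipschitzOnWith K (extChartAt (𝓡 d) x) (ball x r) ∧
    LipschitzOnWith K (extChartAt (𝓡 d) x).symm (ball (extChartAt (𝓡 d) x x) s) := by
  obtain ⟨K, s, hs, hK⟩ := exists_lipschitzOnWith_extChartAt (d := d) x
  obtain ⟨K', s', hs', hK'⟩ := exists_lipschitzOnWith_extChartAt_symm (d := d) x
  obtain ⟨r, hr, hrs⟩ := Metric.mem_nhds_iff.1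
    (Filter.inter_mem hs (extChartAt_source_mem_nhds (I := 𝓡 d) x))
  obtain ⟨r', hr', hrs'⟩ := Metric.mem_nhds_iff.1
    (Filter.inter_mem hs' (extChartAt_target_mem_nhds (I := 𝓡 d) x))
  exact ⟨max 1 (max K K'), le_max_left _ _, r, hr, r', hr', fun y hy ↦ (hrs hy).2,
    fun y hy ↦ (hrs' hy).2,
    (hK.mono fun y hy ↦ (hrs hy).1).weaken ((le_max_left _ _).trans (le_max_right _ _)),
    (hK'.mono fun y hy ↦ (hrs' hy).1).weaken ((le_max_right _ _).trans (le_max_right _ _))⟩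

instance isAddHaarMeasure_hausdorffMeasure_euclideanSpace :
    IsAddHaarMeasure (μH[d] : Measure (EuclideanSpace ℝ (Fin d))) := by
  simpa using MeasureTheory.isAddHaarMeasure_hausdorffMeasure (E := EuclideanSpace ℝ (Fin d))

variable [MeasurableSpace M] [BorelSpace M]

/-- Around each point, the `d`-dimensional Hausdorff measures of concentric balls of proportional
radii are comparable and finite. -/
lemma exists_hausdorffMeasure_closedBall_le (x₀ : M) {T : ℝ} (hT : 0 < T) :
    ∃ C : ℝ≥0, ∃ R₀ > 0, ∀ᶠ x in 𝓝 x₀, ∀ y R, 0 < R → R < R₀ → dist x y ≤ R →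
      (μH[d] (closedBall x (T * R)) ≤ C * μH[d] (ball y R) ∧ 0 < (μH[d] : Measure M) (ball y R) ∧
        (μH[d] : Measure M) (closedBall x (T * R)) < ⊤) := by
  obtain ⟨K, hK1, r, hr, s, hs, hrs, hst, hφ, hψ⟩ := exists_biLipschitz_chart (d := d) x₀
  set φ := extChartAt (𝓡 d) x₀
  have hK0 : (0 : ℝ) < K := one_pos.trans_le hK1
  set ν : Measure (EuclideanSpace ℝ (Fin d)) := μH[d] with hν
  set c := ν (ball 0 1) with hc
  have hc0 : c ≠ 0 := (measure_ball_pos ν _ one_pos).ne'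
  have hct : c ≠ ⊤ := measure_ball_lt_top.ne
  -- radius of the ball of base points and scale
  set q : ℝ := min (r / 2) (s / (2 * K)) with hq
  have hq0 : 0 < q := lt_min (by positivity) (by positivity)
  have hqr : 2 * q ≤ r := by linarith [min_le_left (r / 2) (s / (2 * K))]
  have hqs : 2 * (K * q) ≤ s := by
    have := min_le_right (r / 2) (s / (2 * K))
    rw [← hq, le_div_iff₀ (by positivity)] at this
    linarith
  set R₀ : ℝ := min (q / 2) (q / (2 * T)) with hR₀
  have hR0 : 0 < R₀ := lt_min (by positivity) (by positivity)
  -- One `K ^ d` for each passage through the chart; the middle factor is the ratio of the Euclidean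
  -- volumes of balls of radii `K * T * R` and `R / K`.
  refine ⟨K ^ d * (K * Real.toNNReal T * K) ^ d * K ^ d, R₀, hR0, ?_⟩
  filter_upwards [ball_mem_nhds x₀ (half_pos hq0)] with x hx y R hR hRR hxy
  rw [mem_ball] at hx
  have hR1 : R < q / 2 := hRR.trans_le (min_le_left _ _)
  have hR2 : T * R < q / 2 := by
    have := hRR.trans_le (min_le_right _ _)
    rw [lt_div_iff₀ (by positivity)] at this
    linarith
  have hφx : ∀ z ∈ ball x₀ q, φ z ∈ ball (φ x₀) (K * q) := fun z hz ↦ by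
    have h := hφ.dist_le_mul z (ball_subset_ball (by linarith) hz) x₀ (mem_ball_self hr)
    rw [mem_ball] at hz ⊢
    exact h.trans_lt (by gcongr)
  have hKs : K * q < s := by nlinarith
  -- upper bound
  have hup : μH[d] (closedBall x (T * R)) ≤
      (K : ℝ≥0∞) ^ (d : ℝ) * ν (closedBall (φ x) (K * (T * R))) := by
    have hsub : closedBall x (T * R) ⊆ ball x₀ q := fun z hz ↦ by
      rw [mem_closedBall] at hz
      rw [mem_ball]
      linarith [dist_triangle z x x₀]
    have himg : φ '' closedBall x (T * R) ⊆ closedBall (φ x) (K * (T * R)) := by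
      rintro _ ⟨z, hz, rfl⟩
      have h := hφ.dist_le_mul z (ball_subset_ball (by linarith) (hsub hz)) x
        (by rw [mem_ball]; linarith)
      rw [mem_closedBall] at hz ⊢
      exact h.trans (by gcongr)
    have himg' : φ '' closedBall x (T * R) ⊆ ball (φ x₀) s := by
      rintro _ ⟨z, hz, rfl⟩
      exact ball_subset_ball hKs.le (hφx z (hsub hz))
    have heq : φ.symm '' (φ '' closedBall x (T * R)) = closedBall x (T * R) := by
      rw [image_image]
      refine (image_congr fun z hz ↦ ?_).trans (image_id' _)
      exact φ.left_inv (hrs (ball_subset_ball (by linarith) (hsub hz)))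
    calc μH[d] (closedBall x (T * R)) = μH[d] (φ.symm '' (φ '' closedBall x (T * R))) := by rw [heq]
      _ ≤ (K : ℝ≥0∞) ^ (d : ℝ) * ν (φ '' closedBall x (T * R)) :=
        (hψ.mono himg').hausdorffMeasure_image_le (Nat.cast_nonneg d)
      _ ≤ _ := by gcongr
  -- lower bound
  have hdown : ν (ball (φ y) (R / K)) ≤ (K : ℝ≥0∞) ^ (d : ℝ) * μH[d] (ball y R) := by
    have hy : dist y x₀ < q := by linarith [dist_triangle y x x₀, dist_comm x y]
    have hsub : ball y R ⊆ ball x₀ r := fun z hz ↦ by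
      rw [mem_ball] at hz ⊢
      linarith [dist_triangle z y x₀]
    refine (measure_mono ?_).trans ((hφ.mono hsub).hausdorffMeasure_image_le (Nat.cast_nonneg d))
    intro u hu
    have hφy := hφx y hy
    have hu' : u ∈ ball (φ x₀) s := by
      rw [mem_ball] at hu hφy ⊢
      have : R / K ≤ R := div_le_self hR.le hK1
      have h2 : q ≤ K * q := le_mul_of_one_le_left hq0.le hK1
      linarith [dist_triangle u (φ y) (φ x₀)]
    refine ⟨φ.symm u, ?_, φ.right_inv (hst hu')⟩
    have h := hψ.dist_le_mul u hu' (φ y) (ball_subset_ball hKs.le hφy)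
    rw [φ.left_inv (hrs (ball_subset_ball (by linarith) hy))] at h
    rw [mem_ball] at hu ⊢
    rw [lt_div_iff₀ hK0] at hu
    linarith
  rw [addHaar_closedBall ν _ (by positivity), ← hc] at hup
  rw [addHaar_ball_of_pos ν _ (by positivity), ← hc] at hdown
  rw [finrank_euclideanSpace_fin, ENNReal.rpow_natCast] at hup hdown
  refine ⟨hup.trans ?_, ?_, hup.trans_lt ?_⟩
  · have h1 : (K * (T * R)) ^ d = (K * T * K) ^ d * (R / K) ^ d := by
      rw [← mul_pow]
      congr 1
      field_simp
    rw [h1, ENNReal.ofReal_mul (by positivity)]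
    have h2 : ENNReal.ofReal ((K * T * K) ^ d) = ((K * Real.toNNReal T * K : ℝ≥0) : ℝ≥0∞) ^ d := by
      rw [ENNReal.ofReal_pow (by positivity), ENNReal.ofReal_mul (by positivity),
        ENNReal.ofReal_mul (by positivity), ENNReal.ofReal_coe_nnreal]
      push_cast
      rfl
    rw [h2]
    push_cast
    calc (K : ℝ≥0∞) ^ d * ((K * Real.toNNReal T * K : ℝ≥0∞) ^ d * ENNReal.ofReal ((R / K) ^ d) * c)
        = K ^ d * (K * Real.toNNReal T * K : ℝ≥0∞) ^ d * (ENNReal.ofReal ((R / K) ^ d) * c) := by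
          ring
      _ ≤ K ^ d * (K * Real.toNNReal T * K : ℝ≥0∞) ^ d * (K ^ d * μH[d] (ball y R)) := by gcongr
      _ = _ := by ring
  · have h1 : 0 < ENNReal.ofReal ((R / K) ^ d) * c :=
      ENNReal.mul_pos (ENNReal.ofReal_pos.2 (by positivity)).ne' hc0
    exact (CanonicallyOrderedAdd.mul_pos.1 (h1.trans_le hdown)).2
  · exact ENNReal.mul_lt_top (ENNReal.pow_lt_top ENNReal.coe_lt_top)
      (ENNReal.mul_lt_top ENNReal.ofReal_lt_top hct.lt_top)

lemma exists_doubling [CompactSpace M] {T : ℝ} (hT : 0 < T) :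
    ∃ C : ℝ≥0, ∃ R₀ > 0, ∀ x y : M, ∀ R, 0 < R → R < R₀ → dist x y ≤ R →
      μH[d] (closedBall x (T * R)) ≤ C * μH[d] (ball y R) := by
  obtain ⟨C, R₀, hR₀, h⟩ := exists_uniform_of_eventually (M := M)
    (Q := fun C R₀ x ↦ ∀ y R, 0 < R → R < R₀ → dist x y ≤ R →
      μH[d] (closedBall x (T * R)) ≤ C * μH[d] (ball y R))
    (fun hC hR h y R h0 h1 h2 ↦ (h y R h0 (h1.trans_le hR) h2).trans (by gcongr))
    (fun x₀ ↦ by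
      obtain ⟨C, R₀, hR₀, h⟩ := exists_hausdorffMeasure_closedBall_le (d := d) x₀ hT
      exact ⟨C, R₀, hR₀, h.mono fun x hx y R h0 h1 h2 ↦ (hx y R h0 h1 h2).1⟩)
  exact ⟨C, R₀, hR₀, h⟩

lemma isFiniteMeasure_hausdorffMeasure [CompactSpace M] :
    IsFiniteMeasure (μH[d] : Measure M) := by
  have : IsLocallyFiniteMeasure (μH[d] : Measure M) := by
    refine ⟨fun x ↦ ?_⟩
    obtain ⟨C, R₀, hR₀, h⟩ := exists_hausdorffMeasure_closedBall_le (d := d) x one_pos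
    exact ⟨closedBall x (1 * (R₀ / 2)), closedBall_mem_nhds _ (by positivity),
      (h.self_of_nhds x (R₀ / 2) (by positivity) (by linarith) (by simpa using (half_pos hR₀).le)).2.2⟩
  exact CompactSpace.isFiniteMeasure

lemma hausdorffMeasure_pos_of_isOpen {U : Set M} (hU : IsOpen U) (hne : U.Nonempty) :
    0 < (μH[d] : Measure M) U := by
  obtain ⟨x, hx⟩ := hne
  obtain ⟨r, hr, hrU⟩ := Metric.isOpen_iff.1 hU x hx
  obtain ⟨C, R₀, hR₀, h⟩ := exists_hausdorffMeasure_closedBall_le (d := d) x one_pos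
  have hm : 0 < min (R₀ / 2) r := lt_min (by positivity) hr
  refine (h.self_of_nhds x _ hm ((min_le_left _ _).trans_lt (half_lt_self hR₀))
    (by simpa using hm.le)).2.1.trans_le
    (measure_mono ((ball_subset_ball (min_le_right _ _)).trans hrU))

/-- Lipschitz maps preserve `μH[d]`-null sets, and Lebesgue measure is absolutely continuous with
respect to `μH[d]` on Euclidean space. A chart is Lipschitz only near each point of its source, so
nullity is checked locally. -/
lemma isLebesgueNull_of_hausdorffMeasure {A : Set M} (hA : (μH[d] : Measure M) A = 0) :
    IsLebesgueNull d A := by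
  intro x
  set φ := extChartAt (𝓡 d) x
  have hac : (volume : Measure (EuclideanSpace ℝ (Fin d))) ≪ μH[d] :=
    absolutelyContinuous_isAddHaarMeasure _ _
  refine hac (measure_null_of_locally_null _ ?_)
  rintro _ ⟨y, ⟨hyA, hy⟩, rfl⟩
  have hsm : ContMDiffAt (𝓡 d) 𝓘(ℝ, EuclideanSpace ℝ (Fin d)) 1 φ y :=
    contMDiffAt_extChartAt' (by simpa [φ] using hy)
  obtain ⟨K, s, hs, hK⟩ := exists_lipschitzOnWith_of_contMDiffAt hsm
  have hnhds : φ.symm ⁻¹' s ∩ φ.target ∈ 𝓝 (φ y) := by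
    refine Filter.inter_mem ((continuousAt_extChartAt_symm' hy).preimage_mem_nhds ?_)
      ((isOpen_extChartAt_target x).mem_nhds (φ.map_source hy))
    rwa [φ.left_inv hy]
  refine ⟨_, Filter.inter_mem (mem_nhdsWithin_of_mem_nhds hnhds) self_mem_nhdsWithin, ?_⟩
  refine measure_mono_null (t := φ '' (A ∩ s)) ?_ ?_
  · rintro _ ⟨⟨h1, h2⟩, z, ⟨hzA, hz⟩, rfl⟩
    rw [mem_preimage, φ.left_inv hz] at h1
    exact ⟨z, ⟨hzA, h1⟩, rfl⟩
  · refine le_antisymm (((hK.mono inter_subset_right).hausdorffMeasure_image_le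
      (Nat.cast_nonneg d)).trans ?_) bot_le
    rw [measure_mono_null inter_subset_left hA, mul_zero]

end HausdorffMeasure

/-! ### Locally Hölder functions -/

/-- `φ` is `α`-Hölder on a neighbourhood of `x`. -/
def HolderNear {X : Type*} [MetricSpace X] (α : ℝ≥0) (φ : X → ℝ) (x : X) : Prop :=
  ∃ C : ℝ, 0 ≤ C ∧ ∃ s ∈ 𝓝 x, ∀ y ∈ s, ∀ z ∈ s, |φ y - φ z| ≤ C * dist y z ^ (α : ℝ)

namespace HolderNear

variable {X Y : Type*} [MetricSpace X] [MetricSpace Y] {α : ℝ≥0} {φ ψ : X → ℝ} {x : X}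

/-- At distances at most `1`, `dist ≤ dist ^ α` since `α ≤ 1`; the ball of radius `1 / 2` ensures
this. -/
lemma of_lipschitzOnWith (hα : α ≤ 1) {K : ℝ≥0} {s : Set X} (hs : s ∈ 𝓝 x)
    (h : LipschitzOnWith K φ s) : HolderNear α φ x := by
  refine ⟨K, K.2, s ∩ Metric.ball x (1 / 2),
    Filter.inter_mem hs (Metric.ball_mem_nhds _ (by norm_num)), fun y hy z hz ↦ ?_⟩
  have h1 := h.dist_le_mul y hy.1 z hz.1
  rw [Real.dist_eq] at h1
  have h2 : dist y z ≤ 1 := by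
    have := dist_triangle_right y z x
    have := hy.2; have := hz.2
    rw [Metric.mem_ball] at *
    linarith
  have h3 : dist y z ≤ dist y z ^ (α : ℝ) := by
    rcases eq_or_ne (dist y z) 0 with h0 | h0
    · rw [h0]; positivity
    · exact Real.self_le_rpow_of_le_one dist_nonneg h2 (by exact_mod_cast hα)
  exact h1.trans (by gcongr)

lemma const (c : ℝ) : HolderNear α (fun _ : X ↦ c) x :=
  ⟨0, le_rfl, univ, Filter.univ_mem, by simp⟩

lemma congr (h : HolderNear α φ x) (h' : φ =ᶠ[𝓝 x] ψ) : HolderNear α ψ x := by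
  obtain ⟨C, hC, s, hs, h⟩ := h
  refine ⟨C, hC, s ∩ {y | φ y = ψ y}, Filter.inter_mem hs h', fun y hy z hz ↦ ?_⟩
  rw [← hy.2, ← hz.2]
  exact h y hy.1 z hz.1

lemma add (h : HolderNear α φ x) (h' : HolderNear α ψ x) :
    HolderNear α (fun y ↦ φ y + ψ y) x := by
  obtain ⟨C, hC, s, hs, h⟩ := h
  obtain ⟨C', hC', s', hs', h'⟩ := h'
  refine ⟨C + C', by positivity, s ∩ s', Filter.inter_mem hs hs', fun y hy z hz ↦ ?_⟩
  rw [add_mul]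
  calc |φ y + ψ y - (φ z + ψ z)| = |(φ y - φ z) + (ψ y - ψ z)| := by ring_nf
    _ ≤ _ := (abs_add_le _ _).trans (add_le_add (h y hy.1 z hz.1) (h' y hy.2 z hz.2))

lemma const_mul (c : ℝ) (h : HolderNear α φ x) : HolderNear α (fun y ↦ c * φ y) x := by
  obtain ⟨C, hC, s, hs, h⟩ := h
  refine ⟨|c| * C, by positivity, s, hs, fun y hy z hz ↦ ?_⟩
  rw [← mul_sub, abs_mul, mul_assoc]
  exact mul_le_mul_of_nonneg_left (h y hy z hz) (abs_nonneg c)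

lemma exists_bound (h : HolderNear α φ x) : ∃ B : ℝ, 0 ≤ B ∧ ∀ᶠ y in 𝓝 x, |φ y| ≤ B := by
  obtain ⟨C, hC, s, hs, h⟩ := h
  refine ⟨|φ x| + C, by positivity, ?_⟩
  filter_upwards [hs, Metric.ball_mem_nhds x one_pos] with y hy hy1
  have h1 := h y hy x (mem_of_mem_nhds hs)
  have h2 : dist y x ^ (α : ℝ) ≤ 1 :=
    Real.rpow_le_one dist_nonneg (Metric.mem_ball.1 hy1).le α.2
  have h3 := abs_sub_abs_le_abs_sub (φ y) (φ x)
  nlinarith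

lemma mul (h : HolderNear α φ x) (h' : HolderNear α ψ x) :
    HolderNear α (fun y ↦ φ y * ψ y) x := by
  obtain ⟨B, hB, hb⟩ := h.exists_bound
  obtain ⟨B', hB', hb'⟩ := h'.exists_bound
  obtain ⟨C, hC, s, hs, h⟩ := h
  obtain ⟨C', hC', s', hs', h'⟩ := h'
  refine ⟨B * C' + B' * C, by positivity, (s ∩ s') ∩ ({y | |φ y| ≤ B} ∩ {y | |ψ y| ≤ B'}),
    Filter.inter_mem (Filter.inter_mem hs hs') (Filter.inter_mem hb hb'), fun y hy z hz ↦ ?_⟩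
  calc |φ y * ψ y - φ z * ψ z| = |φ y * (ψ y - ψ z) + ψ z * (φ y - φ z)| := by ring_nf
    _ ≤ |φ y| * |ψ y - ψ z| + |ψ z| * |φ y - φ z| := by
      rw [← abs_mul, ← abs_mul]; exact abs_add_le _ _
    _ ≤ B * (C' * dist y z ^ (α : ℝ)) + B' * (C * dist y z ^ (α : ℝ)) := by
      have := h y hy.1.1 z hz.1.1
      have := h' y hy.1.2 z hz.1.2
      have := hy.2.1
      have := hz.2.2
      simp only [mem_ofPred_eq] at *
      gcongr
    _ = _ := by ring

lemma sum {ι : Type*} {s : Finset ι} {φ : ι → X → ℝ} (h : ∀ i ∈ s, HolderNear α (φ i) x) :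
    HolderNear α (fun y ↦ ∑ i ∈ s, φ i y) x := by
  classical
  induction s using Finset.induction_on with
  | empty => simpa using const 0
  | insert i s hi ih =>
    simp only [Finset.sum_insert hi]
    exact (h i (Finset.mem_insert_self _ _)).add
      (ih fun j hj ↦ h j (Finset.mem_insert_of_mem hj))

lemma comp_lipschitzOnWith {φ : Y → ℝ} {g : X → Y} (h : HolderNear α φ (g x)) {K : ℝ≥0}
    {t : Set X} (ht : t ∈ 𝓝 x) (hg : LipschitzOnWith K g t) :
    HolderNear α (fun y ↦ φ (g y)) x := by
  obtain ⟨C, hC, s, hs, h⟩ := h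
  have hcont : ContinuousAt g x := hg.continuousOn.continuousAt ht
  refine ⟨C * K ^ (α : ℝ), by positivity, t ∩ g ⁻¹' s,
    Filter.inter_mem ht (hcont.preimage_mem_nhds hs), fun y hy z hz ↦ (h _ hy.2 _ hz.2).trans ?_⟩
  rw [mul_assoc, ← Real.mul_rpow K.coe_nonneg dist_nonneg]
  exact mul_le_mul_of_nonneg_left
    (Real.rpow_le_rpow dist_nonneg (hg.dist_le_mul y hy.1 z hz.1) α.2) hC

lemma continuousAt (hα : 0 < α) (h : HolderNear α φ x) : ContinuousAt φ x := by
  obtain ⟨C, hC, s, hs, h⟩ := h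
  rw [ContinuousAt, tendsto_iff_dist_tendsto_zero]
  have h1 : Filter.Tendsto (fun y ↦ C * dist y x ^ (α : ℝ)) (𝓝 x) (𝓝 0) := by
    have : ContinuousAt (fun y ↦ C * dist y x ^ (α : ℝ)) x :=
      continuousAt_const.mul ((continuousAt_id.dist continuousAt_const).rpow_const
        (Or.inr α.2))
    simpa [ContinuousAt, Real.zero_rpow (NNReal.coe_pos.2 hα).ne'] using this
  refine squeeze_zero' (Filter.Eventually.of_forall fun _ ↦ dist_nonneg) ?_ h1
  filter_upwards [hs] with y hy
  rw [Real.dist_eq]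
  exact h y hy x (mem_of_mem_nhds hs)

lemma log (hα : 0 < α) (h : HolderNear α φ x) (hx : 0 < φ x) :
    HolderNear α (fun y ↦ Real.log (φ y)) x := by
  have hc := h.continuousAt hα
  obtain ⟨K, t, ht, hK⟩ : ∃ K : ℝ≥0, ∃ t ∈ 𝓝 (φ x), LipschitzOnWith K Real.log t :=
    (Real.contDiffAt_log.2 hx.ne' : ContDiffAt ℝ 1 Real.log (φ x)).exists_lipschitzOnWith
  obtain ⟨C, hC, s, hs, h⟩ := h
  refine ⟨K * C, by positivity, s ∩ φ ⁻¹' t, Filter.inter_mem hs (hc.preimage_mem_nhds ht),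
    fun y hy z hz ↦ ?_⟩
  have h1 := hK.dist_le_mul _ hy.2 _ hz.2
  rw [Real.dist_eq, Real.dist_eq] at h1
  rw [mul_assoc]
  exact h1.trans (mul_le_mul_of_nonneg_left (h y hy.1 z hz.1) K.2)

end HolderNear

/-! ### Hölder regularity of the conformal factor. -/

section Metric

variable {d : ℕ} {M : Type*} [MetricSpace M] [ChartedSpace (EuclideanSpace ℝ (Fin d)) M]
  [IsManifold (𝓡 d) ∞ M] [RiemannianBundle (fun x : M ↦ TangentSpace (𝓡 d) x)]
  [IsContMDiffRiemannianBundle (𝓡 d) ∞ (EuclideanSpace ℝ (Fin d))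
    (fun x : M ↦ TangentSpace (𝓡 d) x)]

/-- In a chart, the Riemannian metric is a quadratic form with `C^1` coefficients. -/
lemma exists_metric_coefficients (x : M) : ∃ Q : Fin d → Fin d → M → ℝ,
    (∀ k l, ContMDiffAt (𝓡 d) 𝓘(ℝ) 1 (Q k l) x) ∧
    ∀ y ∈ (extChartAt (𝓡 d) x).source, ∀ v : TangentSpace (𝓡 d) y,
      ‖v‖ ^ 2 = ∑ k, ∑ l,
        (show EuclideanSpace ℝ (Fin d) from mfderiv (𝓡 d) (𝓡 d) (extChartAt (𝓡 d) x) y v) k *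
        (show EuclideanSpace ℝ (Fin d) from mfderiv (𝓡 d) (𝓡 d) (extChartAt (𝓡 d) x) y v) l *
        Q k l y := by
  set e := trivializationAt (EuclideanSpace ℝ (Fin d)) (TangentSpace (𝓡 d) : M → Type _) x with he
  set b := (EuclideanSpace.basisFun (Fin d) ℝ).toBasis with hb
  refine ⟨fun k l y ↦ inner ℝ (e.localFrame b k y) (e.localFrame b l y), fun k l ↦ ?_, ?_⟩
  · have : IsContMDiffRiemannianBundle (𝓡 d) 1 (EuclideanSpace ℝ (Fin d))
        (fun x : M ↦ TangentSpace (𝓡 d) x) :=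
      IsContMDiffRiemannianBundle.of_le (n := ∞) (by exact_mod_cast le_top)
    have hx : x ∈ e.baseSet := FiberBundle.mem_baseSet_trivializationAt' x
    exact ContMDiffAt.inner_bundle (contMDiffAt_localFrame_of_mem 1 e b k hx)
      (contMDiffAt_localFrame_of_mem 1 e b l hx)
  · intro y hy v
    have hy' : y ∈ (chartAt (EuclideanSpace ℝ (Fin d)) x).source := by simpa using hy
    have hye : y ∈ e.baseSet := by simpa [he] using hy'
    set u : EuclideanSpace ℝ (Fin d) := mfderiv (𝓡 d) (𝓡 d) (extChartAt (𝓡 d) x) y v with hu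
    have hv : v = ∑ k, u k • e.localFrame b k y := by
      have h1 : e.continuousLinearMapAt ℝ y v = u := by
        rw [hu, TangentBundle.continuousLinearMapAt_trivializationAt hy']
        rfl
      have h2 : e.symmL ℝ y u = v := by
        rw [← h1]; exact e.symmL_continuousLinearMapAt hye v
      have h3 : u = ∑ k, u k • b k := by
        have := (EuclideanSpace.basisFun (Fin d) ℝ).sum_repr u
        simpa [hb] using this.symm
      rw [← h2]
      conv_lhs => rw [h3, map_sum]
      refine Finset.sum_congr rfl fun k _ ↦ ?_
      rw [map_smul, e.localFrame_apply_of_mem_baseSet b hye]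
      simp only [Trivialization.basisAt, Module.Basis.map_apply,
        Trivialization.linearEquivAt_symm_apply]
      rw [e.symmL_apply hye (b k)]
    have hsum : inner ℝ v v = ∑ k, ∑ l, u k * u l *
        inner ℝ (e.localFrame b k y) (e.localFrame b l y) := by
      conv_lhs => rw [hv]
      rw [sum_inner]
      refine Finset.sum_congr rfl fun k _ ↦ ?_
      rw [inner_sum]
      refine Finset.sum_congr rfl fun l _ ↦ ?_
      rw [real_inner_smul_left, real_inner_smul_right, mul_assoc]
    rw [← real_inner_self_eq_norm_sq, hsum]

variable [IsRiemannianManifold (𝓡 d) M]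

/-- The logarithm of the conformal factor of a conformal map of class `C^{1+α}` is locally
`α`-Hölder. -/
lemma IsC1Holder.holderNear_log {α : ℝ≥0} (hα₀ : 0 < α) (hα₁ : α ≤ 1) (hd : 0 < d) {g : M → M}
    (hg : IsC1Holder d α g) {c : M → ℝ} (hc : ∀ x, 0 < c x)
    (hconf : ∀ x, ∀ v : TangentSpace (𝓡 d) x, ‖mfderiv (𝓡 d) (𝓡 d) g x v‖ = c x * ‖v‖) (x : M) :
    HolderNear α (fun y ↦ Real.log (c y)) x := by
  obtain ⟨hg1, hgH⟩ := hg
  obtain ⟨C, s, hs, hC⟩ := hgH x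
  obtain ⟨Q, hQ, hQn⟩ := exists_metric_coefficients (d := d) x
  obtain ⟨Q', hQ', hQn'⟩ := exists_metric_coefficients (d := d) (g x)
  set φ := extChartAt (𝓡 d) x with hφ
  set φ' := extChartAt (𝓡 d) (g x) with hφ'
  set G := writtenInExtChartAt (𝓡 d) (𝓡 d) x g with hG
  -- By conformality one test vector determines the factor: `c ^ 2` is the quotient of the squared
  -- norms of `Dg v` and `v`, for the `v` that the chart reads as `e₀`.
  set e₀ : EuclideanSpace ℝ (Fin d) := EuclideanSpace.single ⟨0, hd⟩ 1 with he₀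
  have he₀' : e₀ ≠ 0 := by simp [he₀]
  set u : Fin d → M → ℝ := fun k y ↦ fderiv ℝ G (φ y) e₀ k with hu
  -- the three families of coefficients are locally Hölder
  have hlip : ∀ (q : M → ℝ) (z : M), ContMDiffAt (𝓡 d) 𝓘(ℝ) 1 q z → HolderNear α q z := by
    intro q z hq
    obtain ⟨K, t, ht, hK⟩ := exists_lipschitzOnWith_of_contMDiffAt hq
    exact HolderNear.of_lipschitzOnWith hα₁ ht hK
  obtain ⟨K, t, ht, hK⟩ := exists_lipschitzOnWith_extChartAt (d := d) x
  obtain ⟨K', t', ht', hK'⟩ := exists_lipschitzOnWith_of_contMDiff hg1 x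
  have hu' : ∀ k, HolderNear α (u k) x := by
    intro k
    have h1 : HolderNear α (fun w ↦ fderiv ℝ G w e₀ k) (φ x) := by
      refine ⟨C * ‖e₀‖, by positivity, s, hs, fun y hy z hz ↦ ?_⟩
      have h2 := hC.dist_le hy hz
      rw [dist_eq_norm] at h2
      calc |fderiv ℝ G y e₀ k - fderiv ℝ G z e₀ k|
          = ‖((fderiv ℝ G y - fderiv ℝ G z) e₀) k‖ := by simp [Real.norm_eq_abs]
        _ ≤ ‖(fderiv ℝ G y - fderiv ℝ G z) e₀‖ := PiLp.norm_apply_le _ _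
        _ ≤ ‖fderiv ℝ G y - fderiv ℝ G z‖ * ‖e₀‖ := ContinuousLinearMap.le_opNorm _ _
        _ ≤ C * dist y z ^ (α : ℝ) * ‖e₀‖ := by gcongr
        _ = _ := by ring
    exact h1.comp_lipschitzOnWith ht hK
  set Num : M → ℝ := fun y ↦ ∑ k, ∑ l, u k y * u l y * Q' k l (g y) with hNum
  set Den : M → ℝ := fun y ↦ ∑ k, ∑ l, e₀ k * e₀ l * Q k l y with hDen
  have hNumH : HolderNear α Num x := HolderNear.sum fun k _ ↦ HolderNear.sum fun l _ ↦
    ((hu' k).mul (hu' l)).mul ((hlip _ _ (hQ' k l)).comp_lipschitzOnWith ht' hK')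
  have hDenH : HolderNear α Den x := HolderNear.sum fun k _ ↦ HolderNear.sum fun l _ ↦
    (hlip _ _ (hQ k l)).const_mul _
  -- the conformal factor is the quotient of the two quadratic forms
  have hGd : ∀ᶠ y in 𝓝 x, DifferentiableAt ℝ G (φ y) := by
    have h1 : ContDiffAt ℝ 1 G (φ x) := by
      have := (contMDiffAt_iff.1 (hg1 x)).2
      rwa [ModelWithCorners.range_eq_univ, contDiffWithinAt_univ] at this
    have h2 : ∀ᶠ w in 𝓝 (φ x), DifferentiableAt ℝ G w :=
      (h1.eventually (by simp)).mono fun w hw ↦ hw.differentiableAt one_ne_zero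
    exact (continuousAt_extChartAt x).eventually h2
  have key : ∀ᶠ y in 𝓝 x, 0 < Den y ∧ Num y = c y ^ 2 * Den y := by
    filter_upwards [hGd, extChartAt_source_mem_nhds (I := 𝓡 d) x,
      hg1.continuous.continuousAt.preimage_mem_nhds
        (extChartAt_source_mem_nhds (I := 𝓡 d) (g x))] with y hy1 hy2 hy3
    obtain ⟨v, hv⟩ : ∃ v : TangentSpace (𝓡 d) y,
        mfderiv (𝓡 d) (𝓡 d) φ y v = (show TangentSpace (𝓡 d) (φ y) from e₀) :=
      (isInvertible_mfderiv_extChartAt (I := 𝓡 d) hy2).bijective.2 _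
    have hy2' : y ∈ (chartAt (EuclideanSpace ℝ (Fin d)) x).source := by simpa using hy2
    have hy3' : g y ∈ (chartAt (EuclideanSpace ℝ (Fin d)) (g x)).source := by simpa using hy3
    have hφd : MDifferentiableAt (𝓡 d) (𝓡 d) φ y := mdifferentiableAt_extChartAt hy2'
    have hφd' : MDifferentiableAt (𝓡 d) (𝓡 d) φ' (g y) := mdifferentiableAt_extChartAt hy3'
    have hgd : MDifferentiableAt (𝓡 d) (𝓡 d) g y := (hg1 y).mdifferentiableAt one_ne_zero
    have h1 : mfderiv (𝓡 d) (𝓡 d) (φ' ∘ g) y v =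
        mfderiv (𝓡 d) (𝓡 d) φ' (g y) (mfderiv (𝓡 d) (𝓡 d) g y v) := by
      rw [mfderiv_comp y hφd' hgd]; rfl
    have h2 : mfderiv (𝓡 d) (𝓡 d) (G ∘ φ) y v = fderiv ℝ G (φ y) e₀ := by
      rw [mfderiv_comp y hy1.mdifferentiableAt hφd, mfderiv_eq_fderiv]
      exact congrArg _ hv
    have h3 : φ' ∘ g =ᶠ[𝓝 y] G ∘ φ := by
      filter_upwards [(isOpen_extChartAt_source (I := 𝓡 d) x).mem_nhds hy2] with z hz
      simp only [hG, writtenInExtChartAt, Function.comp_apply]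
      rw [(extChartAt (𝓡 d) x).left_inv hz]
    have h4 : (show EuclideanSpace ℝ (Fin d) from
        mfderiv (𝓡 d) (𝓡 d) φ' (g y) (mfderiv (𝓡 d) (𝓡 d) g y v)) = fderiv ℝ G (φ y) e₀ := by
      rw [← h2, ← h1, h3.mfderiv_eq]
      rfl
    have hv0 : v ≠ 0 := by
      rintro rfl
      rw [map_zero] at hv
      exact he₀' hv.symm
    have hD : ‖v‖ ^ 2 = Den y := by
      rw [hQn y hy2 v, hv]
    have hN : ‖mfderiv (𝓡 d) (𝓡 d) g y v‖ ^ 2 = Num y := by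
      rw [hQn' (g y) hy3, h4]
    refine ⟨?_, ?_⟩
    · rw [← hD]
      have := norm_pos_iff.2 hv0
      positivity
    · rw [← hN, ← hD, hconf]
      ring
  have hx := key.self_of_nhds
  have hDx : 0 < Den x := hx.1
  have hNx : 0 < Num x := by
    rw [hx.2]
    have := hc x
    positivity
  refine HolderNear.congr (((hNumH.log hα₀ hNx).const_mul (1 / 2)).add
    ((hDenH.log hα₀ hDx).const_mul (-(1 / 2)))) ?_
  filter_upwards [key] with y hy
  rw [hy.2, Real.log_mul (pow_ne_zero _ (hc y).ne') hy.1.ne', Real.log_pow]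
  push_cast
  ring

end Metric

/-! ### Conformal local diffeomorphisms with Hölder conformal factor -/

section Lifting

variable {E : Type*} [NormedAddCommGroup E] [NormedSpace ℝ E] {H : Type*} [TopologicalSpace H]
  {I : ModelWithCorners ℝ E H} {M : Type*} [MetricSpace M] [ChartedSpace H M]
  [RiemannianBundle (fun x : M ↦ TangentSpace I x)] [IsRiemannianManifold I M]
  {F : Type*} [NormedAddCommGroup F] [NormedSpace ℝ F] {H' : Type*} [TopologicalSpace H']
  {J : ModelWithCorners ℝ F H'} {N : Type*} [MetricSpace N] [ChartedSpace H' N]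
  [RiemannianBundle (fun x : N ↦ TangentSpace J x)] [IsRiemannianManifold J N]

lemma enorm_le_mul_of_norm_le {V V' : Type*} [SeminormedAddGroup V] [SeminormedAddGroup V']
    {a : V} {b : V'} {C : ℝ≥0} (h : ‖a‖ ≤ C * ‖b‖) : ‖a‖ₑ ≤ C * ‖b‖ₑ := by
  have : ‖a‖₊ ≤ C * ‖b‖₊ := by exact_mod_cast h
  simp only [enorm]
  exact_mod_cast this

/-- If `‖Dh‖ ≤ C` on an open set `W` and the trace on `W` of the preimages of the closed balls of
radius less than `S` around `h y` are closed, then `W` contains the ball of radius `S / C`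
around `y`. -/
lemma mem_of_mul_dist_lt {h : M → N} {W : Set M} (hW : IsOpen W)
    (hh : ContMDiffOn I J 1 h W) {C : ℝ≥0}
    (hC : ∀ y ∈ W, ∀ v : TangentSpace I y, ‖mfderiv I J h y v‖ ≤ C * ‖v‖)
    {y z : M} {S : ℝ} (hy : y ∈ W)
    (hclosed : ∀ s < S, IsClosed (W ∩ h ⁻¹' Metric.closedBall (h y) s))
    (hz : C * dist y z < S) : z ∈ W ∧ dist (h y) (h z) < S := by
  obtain ⟨ℓ, hℓ, hℓS⟩ : ∃ ℓ, dist y z < ℓ ∧ C * ℓ < S := by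
    have h1 : ∀ᶠ ℓ in 𝓝[>] (dist y z), C * ℓ < S := by
      have : ContinuousAt (fun ℓ : ℝ ↦ C * ℓ) (dist y z) := by fun_prop
      exact (this.eventually_lt continuousAt_const hz).filter_mono nhdsWithin_le_nhds
    obtain ⟨ℓ, h2, h3⟩ := (h1.and self_mem_nhdsWithin).exists
    exact ⟨ℓ, h3, h2⟩
  obtain ⟨γ, h0, h1, hγ, hl⟩ := exists_path_of_dist_lt (I := I) hℓ
  have hℓ0 : 0 ≤ ℓ := dist_nonneg.trans hℓ.le
  set A : Set ℝ := γ ⁻¹' (W ∩ h ⁻¹' Metric.closedBall (h y) (C * ℓ)) with hA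
  have key : ∀ t ∈ Icc (0 : ℝ) 1, (∀ s ∈ Icc 0 t, γ s ∈ W) → t ∈ A := by
    intro t ht hs
    refine ⟨hs t ⟨ht.1, le_rfl⟩, ?_⟩
    have h2 := (edist_comp_path_le hW hh (fun y hy v ↦ enorm_le_mul_of_norm_le (hC y hy v)) hγ
      ht.1 hs).trans (mul_le_mul_right ((pathELength_mono le_rfl ht.2).trans hl.le) _)
    rw [h0, edist_dist, ← ENNReal.ofReal_coe_nnreal, ← ENNReal.ofReal_mul C.coe_nonneg,
      ENNReal.ofReal_le_ofReal_iff (mul_nonneg C.coe_nonneg hℓ0)] at h2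
    rwa [mem_preimage, Metric.mem_closedBall']
  -- Continuity induction along the path: `A` is closed by `hclosed`, as `C * ℓ < S`, and extends to
  -- the right because `W` is open and `key` applies as long as the path stays in `W`.
  have hsub : Icc (0 : ℝ) 1 ⊆ A := by
    refine IsClosed.Icc_subset_of_forall_mem_nhdsGT_of_Icc_subset
      (((hclosed _ hℓS).preimage hγ.continuous).inter isClosed_Icc) ?_ ?_
    · exact key 0 (by simp) fun s hs ↦ by
        have : s = 0 := le_antisymm hs.2 hs.1
        rwa [this, h0]
    · intro t ht hsub
      have h3 : γ ⁻¹' W ∈ 𝓝 t :=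
        hγ.continuous.continuousAt.preimage_mem_nhds (hW.mem_nhds (hsub ⟨ht.1, le_rfl⟩).1)
      obtain ⟨u, hu, hu'⟩ := exists_Ico_subset_of_mem_nhds h3 (exists_gt t)
      have h4 : Ioo t (min u 1) ∈ 𝓝[>] t := Ioo_mem_nhdsGT (lt_min hu ht.2)
      filter_upwards [h4] with t' ht'
      have ht1 := ht'.2.trans_le (min_le_right u 1)
      have htu := ht'.2.trans_le (min_le_left u 1)
      refine key t' ⟨ht.1.trans ht'.1.le, ht1.le⟩ fun s hs ↦ ?_
      rcases le_or_gt s t with hst | hst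
      · exact (hsub ⟨hs.1, hst⟩).1
      · exact hu' ⟨hst.le, hs.2.trans_lt htu⟩
  have h1' := hsub (right_mem_Icc.2 zero_le_one)
  rw [hA, mem_preimage, h1] at h1'
  exact ⟨h1'.1, (Metric.mem_closedBall'.1 h1'.2).trans_lt hℓS⟩

end Lifting

section HolderConformal

variable {d : ℕ} {M : Type*} [MetricSpace M] [ChartedSpace (EuclideanSpace ℝ (Fin d)) M]
  [IsManifold (𝓡 d) ∞ M] [RiemannianBundle (fun x : M ↦ TangentSpace (𝓡 d) x)]

/-- `f` is a conformal local diffeomorphism with conformal factor `c`, and `log c` is locally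
`α`-Hölder. -/
structure IsHolderConformal (d : ℕ) {M : Type*} [MetricSpace M]
    [ChartedSpace (EuclideanSpace ℝ (Fin d)) M]
    [IsManifold (𝓡 d) ∞ M] [RiemannianBundle (fun x : M ↦ TangentSpace (𝓡 d) x)]
    (α : ℝ≥0) (f : M → M) (c : M → ℝ) : Prop where
  isLocalDiffeomorph : IsLocalDiffeomorph (𝓡 d) (𝓡 d) 1 f
  norm_mfderiv : ∀ x, ∀ v : TangentSpace (𝓡 d) x, ‖mfderiv (𝓡 d) (𝓡 d) f x v‖ = c x * ‖v‖
  pos : ∀ x, 0 < c x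
  holderNear : ∀ x, HolderNear α (fun y ↦ Real.log (c y)) x

variable {α : ℝ≥0}

lemma isHolderConformal_id : IsHolderConformal d α (id : M → M) (fun _ ↦ 1) where
  isLocalDiffeomorph := (Diffeomorph.refl (𝓡 d) M 1).isLocalDiffeomorph
  norm_mfderiv x v := by rw [mfderiv_id, one_mul]; rfl
  pos _ := one_pos
  holderNear _ := HolderNear.const _

omit [IsManifold (𝓡 d) ∞ M] [RiemannianBundle (fun x : M ↦ TangentSpace (𝓡 d) x)] in
lemma exists_tangent_ne_zero (hd : 0 < d) (x : M) : ∃ v : TangentSpace (𝓡 d) x, v ≠ 0 := by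
  refine ⟨(show EuclideanSpace ℝ (Fin d) from EuclideanSpace.single ⟨0, hd⟩ 1), fun h ↦ ?_⟩
  have h' : EuclideanSpace.single (⟨0, hd⟩ : Fin d) (1 : ℝ) = 0 := h
  simp at h'

namespace IsHolderConformal

variable {f g : M → M} {c c' : M → ℝ}

lemma contMDiff (h : IsHolderConformal d α f c) : ContMDiff (𝓡 d) (𝓡 d) 1 f :=
  h.isLocalDiffeomorph.contMDiff

lemma continuous (h : IsHolderConformal d α f c) : Continuous f := h.contMDiff.continuous

/-- Applying the inverse derivative to `Df v` with `v ≠ 0` gives `1 ≤ ‖Df⁻¹‖ c`; this turns bounds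
on `invDerivNorm` into bounds on the factor. -/
lemma one_lt_mul (hd : 0 < d) (h : IsHolderConformal d α f c) {x : M} {σ : ℝ}
    (hσ : invDerivNorm d f x < σ) : 1 < σ * c x := by
  obtain ⟨v, hv⟩ := exists_tangent_ne_zero hd x
  have hv' := norm_pos_iff.2 hv
  have hinv : (mfderiv (𝓡 d) (𝓡 d) f x).IsInvertible :=
    ⟨(h.isLocalDiffeomorph x).mfderivToContinuousLinearEquiv one_ne_zero, rfl⟩
  have h1 : (mfderiv (𝓡 d) (𝓡 d) f x).inverse (mfderiv (𝓡 d) (𝓡 d) f x v) = v :=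
    hinv.inverse_apply_eq.2 rfl
  have h2 : ‖v‖ ≤ invDerivNorm d f x * (c x * ‖v‖) := by
    conv_lhs => rw [← h1]
    rw [← h.norm_mfderiv x v]
    exact ContinuousLinearMap.le_opNorm _ _
  have h3 : 1 ≤ invDerivNorm d f x * c x := by
    rw [← mul_assoc] at h2
    exact le_of_mul_le_mul_right (by linarith) hv'
  exact h3.trans_lt (mul_lt_mul_of_pos_right hσ (h.pos x))

/-- The inverse branch of a conformal local diffeomorphism which is injective on an open set. -/
lemma inverse_branch [Nonempty M] (h : IsHolderConformal d α f c) {D : Set M} (hD : IsOpen D)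
    (hinj : InjOn f D) :
    ContMDiffOn (𝓡 d) (𝓡 d) 1 (Function.invFunOn f D) (f '' D) ∧
      ∀ y ∈ D, ∀ v : TangentSpace (𝓡 d) (f y),
        c y * ‖mfderiv (𝓡 d) (𝓡 d) (Function.invFunOn f D) (f y) v‖ = ‖v‖ := by
  have hleft : ∀ y ∈ D, Function.invFunOn f D (f y) = y := fun y hy ↦ hinj.leftInvOn_invFunOn hy
  have heq : ∀ y ∈ D, Function.invFunOn f D =ᶠ[𝓝 (f y)]
      (h.isLocalDiffeomorph y).localInverse := by
    intro y hy
    have hl := h.isLocalDiffeomorph y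
    have hc : ContinuousAt hl.localInverse (f y) := hl.localInverse_contMDiffAt.continuousAt
    have hy' : hl.localInverse (f y) = y := hl.localInverse_left_inv hl.localInverse_mem_target
    have h1 : ∀ᶠ u in 𝓝 (f y), hl.localInverse u ∈ D :=
      hc.preimage_mem_nhds (by rw [hy']; exact hD.mem_nhds hy)
    filter_upwards [h1, hl.localInverse_eventuallyEq_right] with u hu hu'
    simp only [Function.comp_apply, id] at hu'
    conv_lhs => rw [← hu']
    exact hleft _ hu
  have hsm : ∀ y ∈ D, ContMDiffAt (𝓡 d) (𝓡 d) 1 (Function.invFunOn f D) (f y) := fun y hy ↦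
    (h.isLocalDiffeomorph y).localInverse_contMDiffAt.congr_of_eventuallyEq (heq y hy)
  refine ⟨?_, fun y hy v ↦ ?_⟩
  · rintro _ ⟨y, hy, rfl⟩
    exact (hsm y hy).contMDiffWithinAt
  · have hid : f ∘ Function.invFunOn f D =ᶠ[𝓝 (f y)] id := by
      filter_upwards [(h.isLocalDiffeomorph.isOpenMap D hD).mem_nhds (mem_image_of_mem f hy)]
        with u hu
      exact Function.invFunOn_eq hu
    have hcomp : mfderiv (𝓡 d) (𝓡 d) (f ∘ Function.invFunOn f D) (f y) v =
        mfderiv (𝓡 d) (𝓡 d) f (Function.invFunOn f D (f y))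
          (mfderiv (𝓡 d) (𝓡 d) (Function.invFunOn f D) (f y) v) := by
      rw [mfderiv_comp (f y) (h.contMDiff.mdifferentiable one_ne_zero _)
        ((hsm y hy).mdifferentiableAt one_ne_zero)]
      rfl
    -- The inverse branch at `f y` equals `y` only propositionally, so the two tangent spaces carry
    -- different norms on the same model space; the norm is transported along the equality.
    have hnorm : ∀ {p q : M} (_ : p = q) (w : EuclideanSpace ℝ (Fin d)),
        ‖(show TangentSpace (𝓡 d) p from w)‖ = ‖(show TangentSpace (𝓡 d) q from w)‖ := by
      rintro p q rfl w
      rfl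
    have h2 := h.norm_mfderiv (Function.invFunOn f D (f y))
      (mfderiv (𝓡 d) (𝓡 d) (Function.invFunOn f D) (f y) v)
    have h3 : (show EuclideanSpace ℝ (Fin d) from
        mfderiv (𝓡 d) (𝓡 d) (f ∘ Function.invFunOn f D) (f y) v) = v := by
      rw [hid.mfderiv_eq, mfderiv_id]
      rfl
    rw [← hcomp] at h2
    have h4 := (hnorm (congrArg f (hleft y hy)) _).symm.trans h2
    rw [congrArg c (hleft y hy)] at h4
    exact h4.symm.trans (congrArg (fun w : TangentSpace (𝓡 d) (f y) ↦ ‖w‖) h3)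

lemma norm_mfderiv_invFunOn_le [Nonempty M] (h : IsHolderConformal d α f c) {D : Set M}
    (hD : IsOpen D) (hinj : InjOn f D) {C : ℝ≥0} (hC : ∀ z ∈ D, 1 ≤ C * c z) :
    ∀ u ∈ f '' D, ∀ v : TangentSpace (𝓡 d) u,
      ‖mfderiv (𝓡 d) (𝓡 d) (Function.invFunOn f D) u v‖ ≤ C * ‖v‖ := by
  rintro _ ⟨z, hz, rfl⟩ v
  rw [← (h.inverse_branch hD hinj).2 z hz v, ← mul_assoc]
  exact le_mul_of_one_le_left (norm_nonneg _) (hC z hz)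

lemma isOpen_image (h : IsHolderConformal d α f c) {D : Set M} (hD : IsOpen D) :
    IsOpen (f '' D) := h.isLocalDiffeomorph.isOpenMap D hD

section Distances

variable [IsRiemannianManifold (𝓡 d) M]

/-- If the conformal factor is at least `1 / C` on `D` and the image of `D` contains a ball around
`f y`, then inverse branches contract distances to `f y` by the factor `C`. -/
lemma dist_le_mul (h : IsHolderConformal d α f c) {D : Set M} (hD : IsOpen D)
    (hinj : InjOn f D) {C : ℝ≥0} (hC : ∀ z ∈ D, 1 ≤ C * c z) {y z : M} {R : ℝ} (hy : y ∈ D)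
    (hz : z ∈ D) (hR : Metric.ball (f y) R ⊆ f '' D) (hzR : f z ∈ Metric.ball (f y) R) :
    dist y z ≤ C * dist (f y) (f z) := by
  have : Nonempty M := ⟨y⟩
  have h1 := dist_le_of_ball_subset (I := 𝓡 d) (J := 𝓡 d) (h.isOpen_image hD)
    (h.inverse_branch hD hinj).1
    (fun u hu v ↦ enorm_le_mul_of_norm_le (h.norm_mfderiv_invFunOn_le hD hinj hC u hu v)) hR hzR
  rwa [hinj.leftInvOn_invFunOn hy, hinj.leftInvOn_invFunOn hz] at h1

/-- If the conformal factor is at least `1 / C` on the ball `B(x, S)`, where `f` is injective, then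
the image of this ball contains `B(f x, S / C)`. -/
lemma mem_image_ball [CompactSpace M] (h : IsHolderConformal d α f c) {x : M} {S : ℝ} (hS : 0 < S)
    (hinj : InjOn f (Metric.ball x S)) {C : ℝ≥0} (hC : ∀ z ∈ Metric.ball x S, 1 ≤ C * c z) {u : M}
    (hu : C * dist (f x) u < S) : u ∈ f '' Metric.ball x S := by
  have : Nonempty M := ⟨x⟩
  have hx : x ∈ Metric.ball x S := Metric.mem_ball_self hS
  have hinv : ∀ z ∈ Metric.ball x S, Function.invFunOn f (Metric.ball x S) (f z) = z :=
    fun z hz ↦ hinj.leftInvOn_invFunOn hz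
  -- Path lifting for the inverse branch: the required traces are images of closed balls, hence
  -- compact.
  refine (mem_of_mul_dist_lt (I := 𝓡 d) (J := 𝓡 d) (h.isOpen_image Metric.isOpen_ball)
    (h.inverse_branch Metric.isOpen_ball hinj).1
    (h.norm_mfderiv_invFunOn_le Metric.isOpen_ball hinj hC) (mem_image_of_mem f hx)
    (fun s hs ↦ ?_) hu).1
  rw [hinv x hx]
  have heq : f '' Metric.ball x S ∩
      Function.invFunOn f (Metric.ball x S) ⁻¹' Metric.closedBall x s =
      f '' Metric.closedBall x s := by
    ext w
    constructor
    · rintro ⟨⟨z, hz, rfl⟩, hw⟩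
      rw [mem_preimage, hinv z hz] at hw
      exact ⟨z, hw, rfl⟩
    · rintro ⟨z, hz, rfl⟩
      have hz' := Metric.closedBall_subset_ball hs hz
      exact ⟨⟨z, hz', rfl⟩, by rwa [mem_preimage, hinv z hz']⟩
  rw [heq]
  exact ((Metric.isClosed_closedBall.isCompact).image h.continuous).isClosed

/-- If the conformal factor is at most `C` on `D`, then `D` contains the ball of radius `S / C`
around `y`, as long as the traces on `D` of preimages of balls of radius less than `S` are
closed. -/
lemma ball_subset (h : IsHolderConformal d α f c) {D : Set M} (hD : IsOpen D) {C : ℝ}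
    (hC0 : 0 < C) (hC : ∀ z ∈ D, c z ≤ C) {y : M} {S : ℝ} (hy : y ∈ D)
    (hclosed : ∀ s < S, IsClosed (D ∩ f ⁻¹' Metric.closedBall (f y) s)) :
    Metric.ball y (S / C) ⊆ D := by
  intro z hz
  rw [Metric.mem_ball', lt_div_iff₀ hC0] at hz
  lift C to ℝ≥0 using hC0.le
  refine (mem_of_mul_dist_lt (I := 𝓡 d) (J := 𝓡 d) hD h.contMDiff.contMDiffOn
    (fun w hw v ↦ ?_) hy hclosed (by linarith)).1
  rw [h.norm_mfderiv]
  gcongr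
  exact hC w hw

variable [IsContMDiffRiemannianBundle (𝓡 d) ∞ (EuclideanSpace ℝ (Fin d))
    (fun x : M ↦ TangentSpace (𝓡 d) x)]

lemma comp (hg : IsHolderConformal d α g c') (hf : IsHolderConformal d α f c) :
    IsHolderConformal d α (g ∘ f) (fun x ↦ c' (f x) * c x) where
  isLocalDiffeomorph x := IsLocalDiffeomorphAt.comp (hf := hf.isLocalDiffeomorph x)
    (hg := hg.isLocalDiffeomorph (f x))
  norm_mfderiv x v := by
    rw [mfderiv_comp x (hg.contMDiff.mdifferentiable one_ne_zero _)
      (hf.contMDiff.mdifferentiable one_ne_zero _)]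
    exact (hg.norm_mfderiv (f x) _).trans
      (by rw [mul_assoc]; exact congrArg _ (hf.norm_mfderiv x v))
  pos x := mul_pos (hg.pos _) (hf.pos _)
  holderNear x := by
    obtain ⟨K, t, ht, hK⟩ := exists_lipschitzOnWith_of_contMDiff hf.contMDiff x
    refine (((hg.holderNear (f x)).comp_lipschitzOnWith ht hK).add (hf.holderNear x)).congr
      (Filter.Eventually.of_forall fun y ↦ ?_)
    exact (Real.log_mul (hg.pos _).ne' (hf.pos _).ne').symm

/-- The factor is `|a|`. It cannot vanish, because the derivative is injective on a nonzero tangent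
space. -/
lemma of_isConformal (hα₀ : 0 < α) (hα₁ : α ≤ 1) (hd : 0 < d) (hg : IsC1Holder d α g)
    (hdiff : IsLocalDiffeomorph (𝓡 d) (𝓡 d) 1 g) (hconf : IsConformal d g) :
    ∃ c, IsHolderConformal d α g c := by
  obtain ⟨a, ha⟩ := hconf
  have hnorm : ∀ x, ∀ v : TangentSpace (𝓡 d) x,
      ‖mfderiv (𝓡 d) (𝓡 d) g x v‖ = |a x| * ‖v‖ := by
    intro x v
    obtain ⟨L, hL⟩ := ha x
    rw [hL v, norm_smul, L.norm_map, Real.norm_eq_abs]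
  have hpos : ∀ x, 0 < |a x| := by
    intro x
    refine lt_of_le_of_ne (abs_nonneg _) fun h0 ↦ ?_
    obtain ⟨v, hv⟩ := exists_tangent_ne_zero hd x
    have h1 := hnorm x v
    rw [← h0, zero_mul, norm_eq_zero] at h1
    exact hv (((hdiff x).mfderivToContinuousLinearEquiv one_ne_zero).map_eq_zero_iff.1 h1)
  exact ⟨fun x ↦ |a x|, hdiff, hnorm, hpos, hg.holderNear_log hα₀ hα₁ hd hpos hnorm⟩

end Distances

end IsHolderConformal

variable [IsRiemannianManifold (𝓡 d) M]
  [IsContMDiffRiemannianBundle (𝓡 d) ∞ (EuclideanSpace ℝ (Fin d))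
    (fun x : M ↦ TangentSpace (𝓡 d) x)]

/-- The conformal factor of the map of a word. -/
def wordFactor {k : ℕ} (f : Fin k → M → M) (c : Fin k → M → ℝ) : List (Fin k) → M → ℝ
  | [] => fun _ ↦ 1
  | i :: w => fun x ↦ wordFactor f c w (f i x) * c i x

lemma isHolderConformal_wordMap {k : ℕ} {f : Fin k → M → M} {c : Fin k → M → ℝ}
    (h : ∀ i, IsHolderConformal d α (f i) (c i)) (w : List (Fin k)) :
    IsHolderConformal d α (wordMap f w) (wordFactor f c w) := by
  induction w with
  | nil => exact isHolderConformal_id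
  | cons i w ih => exact ih.comp (h i)

end HolderConformal

/-! ### Dynamical balls along words -/

section DynBalls

variable {M : Type*} [MetricSpace M] {k : ℕ} {f : Fin k → M → M}

omit [MetricSpace M] in
lemma wordMap_append (f : Fin k → M → M) (w w' : List (Fin k)) :
    wordMap f (w ++ w') = wordMap f w' ∘ wordMap f w := by
  induction w with
  | nil => rfl
  | cons i w ih => rw [List.cons_append, wordMap, wordMap, ih, Function.comp_assoc]

lemma continuous_wordMap (hf : ∀ i, Continuous (f i)) (w : List (Fin k)) :
    Continuous (wordMap f w) := by
  induction w with
  | nil => exact continuous_id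
  | cons i w ih => exact ih.comp (hf i)

/-- The closed analogue of `dynBall`. -/
def closedDynBall (f : Fin k → M → M) (x : M) (w : List (Fin k)) (ε : ℝ) : Set M :=
  {y | ∀ j ≤ w.length, dist (wordMap f (w.take j) x) (wordMap f (w.take j) y) ≤ ε}

/-- Splitting off time `0`, with a general predicate so that open and closed dynamical balls share
the recursion. -/
lemma forall_le_length_cons {i : Fin k} {w : List (Fin k)} {x y : M} {p : ℝ → Prop} :
    (∀ j ≤ (i :: w).length,
      p (dist (wordMap f ((i :: w).take j) x) (wordMap f ((i :: w).take j) y))) ↔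
    p (dist x y) ∧ ∀ j ≤ w.length,
      p (dist (wordMap f (w.take j) (f i x)) (wordMap f (w.take j) (f i y))) := by
  constructor
  · intro h
    exact ⟨h 0 (Nat.zero_le _), fun j hj ↦ h (j + 1) (by simpa using hj)⟩
  · rintro ⟨h0, h⟩ (_ | j) hj
    · exact h0
    · exact h j (by simpa using hj)

@[simp] lemma mem_dynBall_nil {x y : M} {ε : ℝ} : y ∈ dynBall f x [] ε ↔ dist x y < ε := by
  simp [dynBall, wordMap]

lemma mem_dynBall_cons {i : Fin k} {w : List (Fin k)} {x y : M} {ε : ℝ} :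
    y ∈ dynBall f x (i :: w) ε ↔ dist x y < ε ∧ f i y ∈ dynBall f (f i x) w ε :=
  forall_le_length_cons (p := (· < ε))

@[simp] lemma mem_closedDynBall_nil {x y : M} {ε : ℝ} :
    y ∈ closedDynBall f x [] ε ↔ dist x y ≤ ε := by
  simp [closedDynBall, wordMap]

lemma mem_closedDynBall_cons {i : Fin k} {w : List (Fin k)} {x y : M} {ε : ℝ} :
    y ∈ closedDynBall f x (i :: w) ε ↔ dist x y ≤ ε ∧ f i y ∈ closedDynBall f (f i x) w ε :=
  forall_le_length_cons (p := (· ≤ ε))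

lemma dist_lt_of_mem_dynBall {x y : M} {w : List (Fin k)} {ε : ℝ} (h : y ∈ dynBall f x w ε) :
    dist x y < ε := h 0 (Nat.zero_le _)

lemma dist_wordMap_lt {x y : M} {w : List (Fin k)} {ε : ℝ} (h : y ∈ dynBall f x w ε) :
    dist (wordMap f w x) (wordMap f w y) < ε := by
  simpa using h w.length le_rfl

lemma dist_wordMap_le {x y : M} {w : List (Fin k)} {ε : ℝ} (h : y ∈ closedDynBall f x w ε) :
    dist (wordMap f w x) (wordMap f w y) ≤ ε := by
  simpa using h w.length le_rfl

lemma closedDynBall_subset_dynBall {x : M} {w : List (Fin k)} {s ε : ℝ} (h : s < ε) :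
    closedDynBall f x w s ⊆ dynBall f x w ε := fun _ hy j hj ↦ (hy j hj).trans_lt h

lemma mem_dynBall_self {x : M} {w : List (Fin k)} {ε : ℝ} (h : 0 < ε) : x ∈ dynBall f x w ε :=
  fun j _ ↦ by simpa using h

lemma isOpen_dynBall (hf : ∀ i, Continuous (f i)) (x : M) (w : List (Fin k)) (ε : ℝ) :
    IsOpen (dynBall f x w ε) := by
  induction w generalizing x with
  | nil =>
    simp only [dynBall, List.length_nil, List.take_nil, wordMap]
    convert! Metric.isOpen_ball (x := x) (ε := ε) using 1
    ext y
    simp [dist_comm]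
  | cons i w ih =>
    convert! (Metric.isOpen_ball (x := x) (ε := ε)).inter ((ih (f i x)).preimage (hf i)) using 1
    ext y
    rw [mem_dynBall_cons, mem_inter_iff, Metric.mem_ball', mem_preimage]

lemma isClosed_closedDynBall (hf : ∀ i, Continuous (f i)) (x : M) (w : List (Fin k)) (ε : ℝ) :
    IsClosed (closedDynBall f x w ε) := by
  simp only [closedDynBall, ofPred_forall]
  exact isClosed_iInter fun j ↦ isClosed_iInter fun _ ↦
    isClosed_le (continuous_const.dist (continuous_wordMap hf _)) continuous_const

lemma closure_dynBall_subset (hf : ∀ i, Continuous (f i)) (x : M) (w : List (Fin k)) (ε : ℝ) :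
    closure (dynBall f x w ε) ⊆ closedDynBall f x w ε :=
  closure_minimal (fun _ hy j hj ↦ (hy j hj).le) (isClosed_closedDynBall hf x w ε)

/-- The orbit of `x` along `w = (i_1, …, i_n)` is at time `j < n` in the `s`-neighbourhood of
`V i_{j+1}`. -/
def Shadows (f : Fin k → M → M) (V : Fin k → Set M) (s : ℝ) : List (Fin k) → M → Prop
  | [] => fun _ ↦ True
  | i :: w => fun x ↦ x ∈ Metric.thickening s (V i) ∧ Shadows f V s w (f i x)

/-- Budget of tolerances: moving within a dynamical `ε`-ball costs `ε`, and the maps are controlled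
while the total is at most `r`. -/
lemma Shadows.of_mem_dynBall {V : Fin k → Set M} {s ε : ℝ} {w : List (Fin k)} {y z : M}
    (h : Shadows f V s w y) (hz : z ∈ dynBall f y w ε) : Shadows f V (s + ε) w z := by
  induction w generalizing y z with
  | nil => trivial
  | cons i w ih =>
    rw [mem_dynBall_cons] at hz
    refine ⟨?_, ih h.2 hz.2⟩
    obtain ⟨v, hv, hyv⟩ := Metric.mem_thickening_iff.1 h.1
    exact Metric.mem_thickening_iff.2 ⟨v, hv, by
      linarith [dist_triangle_left z v y, hz.1]⟩

lemma Shadows.mono {V : Fin k → Set M} {s s' : ℝ} (hs : s ≤ s') {w : List (Fin k)} {y : M}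
    (h : Shadows f V s w y) : Shadows f V s' w y := by
  induction w generalizing y with
  | nil => trivial
  | cons i w ih => exact ⟨Metric.thickening_mono hs _ h.1, ih h.2⟩

end DynBalls

/-! ### Backward contraction, bounded distortion and eccentricity. -/

section Expanding

variable {d : ℕ} {M : Type*} [MetricSpace M] [ChartedSpace (EuclideanSpace ℝ (Fin d)) M]
  [IsManifold (𝓡 d) ∞ M] [RiemannianBundle (fun x : M ↦ TangentSpace (𝓡 d) x)]

/-- Conformal maps `f i`, injective and expanding on the `r`-neighbourhoods of sets `V i`. -/
structure ExpandingMaps (d : ℕ) {M : Type*} [MetricSpace M]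
    [ChartedSpace (EuclideanSpace ℝ (Fin d)) M]
    [IsManifold (𝓡 d) ∞ M] [RiemannianBundle (fun x : M ↦ TangentSpace (𝓡 d) x)]
    (α : ℝ≥0) {k : ℕ} (f : Fin k → M → M) (c : Fin k → M → ℝ) (V : Fin k → Set M) (σ : ℝ≥0)
    (r : ℝ) : Prop where
  conformal : ∀ i, IsHolderConformal d α (f i) (c i)
  σ_lt_one : σ < 1
  injOn : ∀ i, InjOn (f i) (Metric.thickening r (V i))
  expanding : ∀ i, ∀ x ∈ Metric.thickening r (V i), 1 ≤ σ * c i x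

namespace ExpandingMaps

variable {α : ℝ≥0} {k : ℕ} {f : Fin k → M → M} {c : Fin k → M → ℝ} {V : Fin k → Set M}
  {σ : ℝ≥0} {r s ε : ℝ} {w : List (Fin k)} {x y z : M}

lemma continuous (h : ExpandingMaps d α f c V σ r) (i : Fin k) : Continuous (f i) :=
  (h.conformal i).continuous

/-- Injectivity of each letter on its `r`-neighbourhood, used from the last letter backwards: the
endpoint determines a shadowed orbit. -/
lemma eq_of_wordMap_eq (h : ExpandingMaps d α f c V σ r) (hy : Shadows f V r w y)
    (hz : Shadows f V r w z) (heq : wordMap f w y = wordMap f w z) : y = z := by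
  induction w generalizing y z with
  | nil => exact heq
  | cons i w ih => exact h.injOn i hy.1 hz.1 (ih hy.2 hz.2 heq)

lemma injOn_dynBall (h : ExpandingMaps d α f c V σ r) (hsε : s + ε ≤ r)
    (hy : Shadows f V s w y) : InjOn (wordMap f w) (dynBall f y w ε) := fun _ hz _ hz' heq ↦
  h.eq_of_wordMap_eq ((hy.of_mem_dynBall hz).mono hsε) ((hy.of_mem_dynBall hz').mono hsε) heq

lemma ball_subset_thickening {A : Set M} (hsε : s + ε ≤ r) (hy : y ∈ Metric.thickening s A) :
    Metric.ball y ε ⊆ Metric.thickening r A := by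
  intro z hz
  obtain ⟨v, hv, hyv⟩ := Metric.mem_thickening_iff.1 hy
  rw [Metric.mem_ball'] at hz
  exact Metric.mem_thickening_iff.2 ⟨v, hv, by linarith [dist_triangle_left z v y]⟩

/-- The conformal factor along a word grows exponentially. -/
lemma one_le_pow_mul_wordFactor (h : ExpandingMaps d α f c V σ r) (hy : Shadows f V r w y) :
    1 ≤ (σ : ℝ) ^ w.length * wordFactor f c w y := by
  induction w generalizing y with
  | nil => simp [wordFactor]
  | cons i w ih =>
    have h1 := ih hy.2
    have h2 := h.expanding i y hy.1
    have := one_le_mul_of_one_le_of_one_le h1 h2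
    calc (1 : ℝ) ≤ _ := this
      _ = _ := by rw [wordFactor, List.length_cons, pow_succ]; ring

variable [IsRiemannianManifold (𝓡 d) M]

/-- One backward step: `f i` expands by at least `1 / σ > 1` on `B(y, ε)`, so the image contains the
ball of the same radius and the inverse branch contracts there. -/
lemma dist_le_sigma_mul [CompactSpace M] (h : ExpandingMaps d α f c V σ r) (hε : 0 < ε)
    (hsε : s + ε ≤ r) {i : Fin k} (hy : y ∈ Metric.thickening s (V i)) :
    Metric.ball (f i y) ε ⊆ f i '' Metric.ball y ε ∧
      ∀ z ∈ Metric.ball y ε, f i z ∈ Metric.ball (f i y) ε →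
        dist y z ≤ σ * dist (f i y) (f i z) := by
  have hsub := ball_subset_thickening hsε hy
  have hinj := (h.injOn i).mono hsub
  have hC : ∀ z ∈ Metric.ball y ε, 1 ≤ σ * c i z := fun z hz ↦ h.expanding i z (hsub hz)
  have himg : Metric.ball (f i y) ε ⊆ f i '' Metric.ball y ε := fun u hu ↦ by
    refine (h.conformal i).mem_image_ball hε hinj hC ?_
    rw [Metric.mem_ball'] at hu
    exact (mul_le_of_le_one_left dist_nonneg (by exact_mod_cast h.σ_lt_one.le)).trans_lt hu
  exact ⟨himg, fun z hz hfz ↦ (h.conformal i).dist_le_mul Metric.isOpen_ball hinj hC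
    (Metric.mem_ball_self hε) hz himg hfz⟩

/-- Along a shadowed word, distances to the orbit of `y` are contracted backwards. -/
lemma dist_le_pow_mul [CompactSpace M] (h : ExpandingMaps d α f c V σ r) (hsε : s + ε ≤ r)
    (hy : Shadows f V s w y) (hz : z ∈ dynBall f y w ε) :
    dist y z ≤ (σ : ℝ) ^ w.length * dist (wordMap f w y) (wordMap f w z) := by
  induction w generalizing y z with
  | nil => simp [wordMap]
  | cons i w ih =>
    have hε : 0 < ε := dist_nonneg.trans_lt (dist_lt_of_mem_dynBall hz)
    rw [mem_dynBall_cons] at hz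
    have h1 := (h.dist_le_sigma_mul hε hsε hy.1).2 z (Metric.mem_ball'.2 hz.1)
      (Metric.mem_ball'.2 (dist_lt_of_mem_dynBall hz.2))
    refine h1.trans ?_
    rw [List.length_cons, pow_succ', mul_assoc]
    exact mul_le_mul_of_nonneg_left (ih hy.2 hz.2) σ.coe_nonneg

/-- Distances to the orbit of `y` shrink backwards in time, so the final distance bounds all of
them; closeness along the orbit can be tested at the endpoint. -/
lemma mem_closedDynBall [CompactSpace M] (h : ExpandingMaps d α f c V σ r) (hsε : s + ε ≤ r)
    (hy : Shadows f V s w y) (hz : z ∈ dynBall f y w ε) :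
    z ∈ closedDynBall f y w (dist (wordMap f w y) (wordMap f w z)) := by
  have key : dist y z ≤ dist (wordMap f w y) (wordMap f w z) :=
    (h.dist_le_pow_mul hsε hy hz).trans (mul_le_of_le_one_left dist_nonneg
      (pow_le_one₀ σ.coe_nonneg (by exact_mod_cast h.σ_lt_one.le)))
  induction w generalizing y z with
  | nil => simp [wordMap]
  | cons i w ih =>
    have hz' := mem_dynBall_cons.1 hz
    refine mem_closedDynBall_cons.2 ⟨key, ih hy.2 hz'.2 ?_⟩
    exact (h.dist_le_pow_mul hsε hy.2 hz'.2).trans (mul_le_of_le_one_left dist_nonneg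
      (pow_le_one₀ σ.coe_nonneg (by exact_mod_cast h.σ_lt_one.le)))

/-- The map of a shadowed word sends dynamical balls onto balls. -/
lemma image_dynBall [CompactSpace M] (h : ExpandingMaps d α f c V σ r) (hsε : s + ε ≤ r)
    (hy : Shadows f V s w y) :
    wordMap f w '' dynBall f y w ε = Metric.ball (wordMap f w y) ε := by
  refine Subset.antisymm ?_ ?_
  · rintro _ ⟨z, hz, rfl⟩
    exact Metric.mem_ball'.2 (dist_wordMap_lt hz)
  · intro u hu
    have hε : 0 < ε := dist_nonneg.trans_lt hu
    induction w generalizing y with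
    | nil => exact ⟨u, by simpa [wordMap, dist_comm] using hu, rfl⟩
    | cons i w ih =>
      obtain ⟨z, hz, rfl⟩ := ih hy.2 hu
      obtain ⟨z', hz', rfl⟩ := (h.dist_le_sigma_mul hε hsε hy.1).1
        (Metric.mem_ball'.2 (dist_lt_of_mem_dynBall hz))
      exact ⟨z', mem_dynBall_cons.2 ⟨Metric.mem_ball'.1 hz', hz⟩, rfl⟩

variable [IsContMDiffRiemannianBundle (𝓡 d) ∞ (EuclideanSpace ℝ (Fin d))
    (fun x : M ↦ TangentSpace (𝓡 d) x)]

lemma conformal_wordMap (h : ExpandingMaps d α f c V σ r) (w : List (Fin k)) :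
    IsHolderConformal d α (wordMap f w) (wordFactor f c w) :=
  isHolderConformal_wordMap h.conformal w

/-- The word map is open, so it sends the interior of the closure into the interior of a closed-up
ball, which `hint` makes the ball itself; the endpoint then controls the whole orbit. The room `2 *
ε` is needed because points of the closure are only known to be within distance `≤ ε`. -/
lemma interior_closure_dynBall [CompactSpace M] (h : ExpandingMaps d α f c V σ r) (hε : 0 < ε)
    (hsε : s + 2 * ε ≤ r) (hy : Shadows f V s w y)
    (hint : interior (closure (Metric.ball (wordMap f w y) ε)) = Metric.ball (wordMap f w y) ε) :
    interior (closure (dynBall f y w ε)) = dynBall f y w ε := by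
  refine Subset.antisymm (fun z hz ↦ ?_)
    (interior_maximal subset_closure (isOpen_dynBall h.continuous y w ε))
  have hc := continuous_wordMap h.continuous w
  have h1 : wordMap f w '' interior (closure (dynBall f y w ε)) ⊆
      Metric.ball (wordMap f w y) ε := by
    rw [← hint]
    refine interior_maximal ?_ ((h.conformal_wordMap w).isOpen_image isOpen_interior)
    rw [← h.image_dynBall (by linarith) hy]
    exact (image_mono interior_subset).trans (image_closure_subset_closure_image hc)
  have h2 := h1 (mem_image_of_mem _ hz)
  have h3 := closedDynBall_subset_dynBall (show ε < 2 * ε by linarith)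
    (closure_dynBall_subset h.continuous y w ε (interior_subset hz))
  exact closedDynBall_subset_dynBall (Metric.mem_ball'.1 h2) (h.mem_closedDynBall hsε hy h3)

/-- Bounded distortion: a uniform modulus of continuity for the logarithm of the conformal factor
along a shadowed word. -/
lemma abs_log_wordFactor_sub_le [CompactSpace M] (h : ExpandingMaps d α f c V σ r) {C R : ℝ}
    (hC : 0 ≤ C)
    (hlog : ∀ i y z, dist y z < R →
      |Real.log (c i y) - Real.log (c i z)| ≤ C * dist y z ^ (α : ℝ))
    (hεR : ε ≤ R) (hsε : s + ε ≤ r) (hy : Shadows f V s w y) (hz : z ∈ dynBall f y w ε) :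
    |Real.log (wordFactor f c w y) - Real.log (wordFactor f c w z)| ≤
      C * (∑ m ∈ Finset.range w.length, ((σ : ℝ) ^ (α : ℝ)) ^ (m + 1)) *
        dist (wordMap f w y) (wordMap f w z) ^ (α : ℝ) := by
  induction w generalizing y z with
  | nil => simp [wordFactor]
  | cons i w ih =>
    have hz' := mem_dynBall_cons.1 hz
    have h1 := ih hy.2 hz'.2
    have h2 := hlog i y z (hz'.1.trans_le hεR)
    -- The initial distance is at most `σ ^ (w.length + 1)` times the final one, so the first letter
    -- contributes the new last term of the geometric sum.
    have h3 := Real.rpow_le_rpow dist_nonneg (h.dist_le_pow_mul hsε hy hz) α.coe_nonneg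
    rw [Real.mul_rpow (by positivity) dist_nonneg, ← Real.rpow_pow_comm σ.coe_nonneg,
      List.length_cons] at h3
    have h4 := h2.trans (mul_le_mul_of_nonneg_left h3 hC)
    have hp := (h.conformal_wordMap w).pos
    simp only [wordFactor]
    rw [Real.log_mul (hp _).ne' ((h.conformal i).pos _).ne',
      Real.log_mul (hp _).ne' ((h.conformal i).pos _).ne', List.length_cons,
      Finset.sum_range_succ]
    set D := dist (wordMap f (i :: w) y) (wordMap f (i :: w) z) with hD
    have hD' : dist (wordMap f w (f i y)) (wordMap f w (f i z)) = D := rfl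
    rw [hD'] at h1
    calc |Real.log (wordFactor f c w (f i y)) + Real.log (c i y) -
          (Real.log (wordFactor f c w (f i z)) + Real.log (c i z))|
        = |(Real.log (wordFactor f c w (f i y)) - Real.log (wordFactor f c w (f i z))) +
          (Real.log (c i y) - Real.log (c i z))| := by ring_nf
      _ ≤ _ := (abs_add_le _ _).trans (add_le_add h1 h4)
      _ = _ := by ring

/-- There is a uniform distortion constant at small scales. -/
lemma exists_distortion [CompactSpace M] (h : ExpandingMaps d α f c V σ r) (hα : 0 < α) :
    ∃ K : ℝ, 1 ≤ K ∧ ∃ R > 0, ∀ (s ε : ℝ) (w : List (Fin k)) (y z : M), ε ≤ R → s + ε ≤ r →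
      Shadows f V s w y → z ∈ dynBall f y w ε →
      wordFactor f c w y ≤ K * wordFactor f c w z ∧
      wordFactor f c w z ≤ K * wordFactor f c w y := by
  obtain ⟨C, R, hR, hlog⟩ := exists_uniform_of_eventually (M := M)
    (Q := fun C R x ↦ ∀ y, dist x y < R → ∀ i,
      |Real.log (c i x) - Real.log (c i y)| ≤ C * dist x y ^ (α : ℝ))
    (fun hC hR h y hy i ↦ (h y (hy.trans_le hR) i).trans
      (mul_le_mul_of_nonneg_right (by exact_mod_cast hC) (by positivity)))
    (fun x ↦ by
      choose C hC s hs hCs using fun i ↦ (h.conformal i).holderNear x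
      have hs' : (⋂ i, s i) ∈ 𝓝 x := Filter.iInter_mem.2 hs
      obtain ⟨ρ, hρ, hρs⟩ := Metric.mem_nhds_iff.1 hs'
      refine ⟨Real.toNNReal (∑ i, C i), ρ / 2, half_pos hρ, ?_⟩
      filter_upwards [Metric.ball_mem_nhds x (half_pos hρ)] with y hy z hyz i
      rw [Metric.mem_ball] at hy
      have hy' : y ∈ Metric.ball x ρ := Metric.mem_ball.2 (by linarith)
      have hz' : z ∈ Metric.ball x ρ :=
        Metric.mem_ball.2 (by linarith [dist_triangle_left z x y])
      refine (hCs i y (mem_iInter.1 (hρs hy') i) z (mem_iInter.1 (hρs hz') i)).trans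
        (mul_le_mul_of_nonneg_right ?_ (by positivity))
      exact (Finset.single_le_sum (fun j _ ↦ hC j) (Finset.mem_univ i)).trans
        (Real.le_coe_toNNReal _))
  set θ : ℝ := (σ : ℝ) ^ (α : ℝ) with hθ
  have hθ0 : 0 ≤ θ := by positivity
  have hθ1 : θ < 1 := Real.rpow_lt_one σ.coe_nonneg (by exact_mod_cast h.σ_lt_one)
    (by exact_mod_cast hα)
  -- This bounds `C` times the geometric sum for words of every length; radii are capped at `1` so
  -- that the remaining factor `dist ^ α` is at most `1`.
  set B : ℝ := C * (1 - θ)⁻¹ with hB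
  have hB0 : 0 ≤ B := mul_nonneg C.coe_nonneg (inv_nonneg.2 (by linarith))
  refine ⟨Real.exp B, Real.one_le_exp hB0, min R 1, lt_min hR one_pos,
    fun s ε w y z hεR hsε hy hz ↦ ?_⟩
  have h1 := h.abs_log_wordFactor_sub_le C.coe_nonneg (fun i y z hyz ↦ hlog y z hyz i)
    (hεR.trans (min_le_left _ _)) hsε hy hz
  have h2 : |Real.log (wordFactor f c w y) - Real.log (wordFactor f c w z)| ≤ B := by
    refine h1.trans ?_
    have h3 : dist (wordMap f w y) (wordMap f w z) ^ (α : ℝ) ≤ 1 :=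
      Real.rpow_le_one dist_nonneg
        ((dist_wordMap_lt hz).le.trans (hεR.trans (min_le_right _ _))) α.coe_nonneg
    have h4 : ∑ m ∈ Finset.range w.length, θ ^ (m + 1) ≤ (1 - θ)⁻¹ := by
      calc ∑ m ∈ Finset.range w.length, θ ^ (m + 1)
          ≤ ∑ m ∈ Finset.range w.length, θ ^ m := Finset.sum_le_sum fun m _ ↦
            pow_le_pow_of_le_one hθ0 hθ1.le (Nat.le_succ m)
        _ ≤ ∑' m, θ ^ m := (summable_geometric_of_lt_one hθ0 hθ1).sum_le_tsum _
            fun m _ ↦ by positivity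
        _ = _ := tsum_geometric_of_lt_one hθ0 hθ1
    have h5 : 0 ≤ ∑ m ∈ Finset.range w.length, θ ^ (m + 1) :=
      Finset.sum_nonneg fun m _ ↦ by positivity
    exact (mul_le_of_le_one_right (mul_nonneg C.coe_nonneg h5) h3).trans
      (mul_le_mul_of_nonneg_left h4 C.coe_nonneg)
  have hpy := (h.conformal_wordMap w).pos y
  have hpz := (h.conformal_wordMap w).pos z
  rw [abs_le] at h2
  constructor
  · rw [← Real.log_le_log_iff hpy (by positivity), Real.log_mul (Real.exp_pos _).ne' hpz.ne',
      Real.log_exp]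
    linarith
  · rw [← Real.log_le_log_iff hpz (by positivity), Real.log_mul (Real.exp_pos _).ne' hpy.ne',
      Real.log_exp]
    linarith

/-- Dynamical balls have bounded eccentricity: they lie between two balls of radii comparable to
the inverse of the conformal factor. -/
lemma dynBall_eccentricity [CompactSpace M] (h : ExpandingMaps d α f c V σ r) {K : ℝ} (hK : 1 ≤ K)
    (hε : 0 < ε) (hsε : s + 2 * ε ≤ r) (hy : Shadows f V s w y)
    (hdist : ∀ z ∈ dynBall f y w (2 * ε), wordFactor f c w y ≤ K * wordFactor f c w z ∧
      wordFactor f c w z ≤ K * wordFactor f c w y) :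
    closure (dynBall f y w ε) ⊆ Metric.closedBall y (K * ε / wordFactor f c w y) ∧
      Metric.ball y (ε / (K * wordFactor f c w y)) ⊆ dynBall f y w ε := by
  have hp := (h.conformal_wordMap w).pos y
  have hK0 : 0 < K := one_pos.trans_le hK
  have hsub2 : dynBall f y w ε ⊆ dynBall f y w (2 * ε) := fun z hz j hj ↦
    (hz j hj).trans (by linarith)
  constructor
  · intro z hz
    have hz1 := closure_dynBall_subset h.continuous y w ε hz
    have hz2 := closedDynBall_subset_dynBall (show ε < 2 * ε by linarith) hz1
    have hKp : 0 ≤ K / wordFactor f c w y := by positivity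
    obtain ⟨q, hq⟩ : ∃ q : ℝ≥0, (q : ℝ) = K / wordFactor f c w y :=
      ⟨Real.toNNReal _, Real.coe_toNNReal _ hKp⟩
    -- Outer ball: on the dynamical `2ε`-ball the inverse branch has derivative at most `K /
    -- wordFactor`, and the closed dynamical ball lies inside it.
    have h1 := (h.conformal_wordMap w).dist_le_mul (C := q)
      (isOpen_dynBall h.continuous y w (2 * ε))
      (h.injOn_dynBall hsε hy) (fun z hz ↦ ?_) (mem_dynBall_self (by linarith)) hz2
      (h.image_dynBall hsε hy).ge (Metric.mem_ball'.2 (dist_wordMap_lt hz2))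
    · rw [Metric.mem_closedBall']
      refine h1.trans ?_
      rw [hq, mul_div_right_comm]
      exact mul_le_mul_of_nonneg_left (dist_wordMap_le hz1) hKp
    · rw [hq, div_mul_eq_mul_div, one_le_div hp]
      exact (hdist z hz).1
  -- Inner ball: the factor is at most `K * wordFactor`, and the traces whose closedness path
  -- continuation needs are closed dynamical balls.
  · refine (h.conformal_wordMap w).ball_subset (isOpen_dynBall h.continuous y w ε)
      (by positivity) (fun z hz ↦ (hdist z (hsub2 hz)).2) (mem_dynBall_self hε) fun t ht ↦ ?_
    have heq : dynBall f y w ε ∩ wordMap f w ⁻¹' Metric.closedBall (wordMap f w y) t =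
        closedDynBall f y w t := by
      refine Subset.antisymm ?_ fun z hz ↦ ⟨closedDynBall_subset_dynBall ht hz,
        Metric.mem_closedBall'.2 (dist_wordMap_le hz)⟩
      rintro z ⟨hz, hzt⟩ j hj
      exact (h.mem_closedDynBall (by linarith) hy hz j hj).trans (Metric.mem_closedBall'.1 hzt)
    rw [heq]
    exact isClosed_closedDynBall h.continuous y w t

end ExpandingMaps

end Expanding

/-! ### Covers by generic balls -/

section Generic

open MeasureTheory

variable {M : Type*} [MetricSpace M]

/-- For a bad radius `ε`, the sphere has a point interior to the closed ball; on a basic open set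
around it, the distance to `p` has maximum `ε`. A countable basis produces only countably many such
maxima. -/
lemma countable_not_interior_closedBall_subset [SecondCountableTopology M] (p : M) :
    {ε : ℝ | ¬ interior (Metric.closedBall p ε) ⊆ Metric.ball p ε}.Countable := by
  refine ((TopologicalSpace.countable_countableBasis M).image
    fun u ↦ sSup ((fun x ↦ dist x p) '' u)).mono ?_
  intro ε hε
  obtain ⟨x, hx, hxε⟩ := not_subset.1 hε
  obtain ⟨u, hu, hxu, hus⟩ := (TopologicalSpace.isBasis_countableBasis M).exists_subset_of_mem_open
    hx isOpen_interior
  refine ⟨u, hu, IsGreatest.csSup_eq ⟨⟨x, hxu, ?_⟩, ?_⟩⟩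
  · exact le_antisymm (Metric.mem_closedBall.1 (interior_subset hx)) (not_lt.1 hxε)
  · rintro _ ⟨y, hy, rfl⟩
    exact Metric.mem_closedBall.1 (interior_subset (hus hy))

/-- Spheres of different radii are disjoint, and a finite measure charges only countably many
disjoint sets. -/
lemma countable_measure_sphere_pos [MeasurableSpace M] [BorelSpace M] (μ : Measure M)
    [IsFiniteMeasure μ] (p : M) : {ε : ℝ | 0 < μ (Metric.sphere p ε)}.Countable := by
  refine Measure.countable_meas_pos_of_disjoint_iUnion
    (fun ε ↦ Metric.isClosed_sphere.measurableSet) fun ε ε' hne ↦ ?_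
  refine Set.disjoint_left.2 fun x hx hx' ↦ hne ?_
  rw [Metric.mem_sphere] at hx hx'
  exact hx.symm.trans hx'

lemma exists_generic_radius [SecondCountableTopology M] [MeasurableSpace M] [BorelSpace M]
    (μ : Measure M) [IsFiniteMeasure μ] {F : Set M} (hF : F.Finite) {a b : ℝ} (hab : a < b) :
    ∃ ε ∈ Ioo a b, ∀ p ∈ F,
      interior (Metric.closedBall p ε) ⊆ Metric.ball p ε ∧ μ (Metric.sphere p ε) = 0 := by
  by_contra! hcon
  have hc : (Ioo a b).Countable := by
    refine (hF.countable.biUnion (t := fun p _ ↦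
      {ε : ℝ | ¬ interior (Metric.closedBall p ε) ⊆ Metric.ball p ε} ∪
        {ε : ℝ | 0 < μ (Metric.sphere p ε)}) fun p _ ↦
      (countable_not_interior_closedBall_subset p).union
        (countable_measure_sphere_pos μ p)).mono fun ε hε ↦ ?_
    obtain ⟨p, hp, h⟩ := hcon ε hε
    refine mem_biUnion hp ?_
    by_cases hi : interior (Metric.closedBall p ε) ⊆ Metric.ball p ε
    · exact Or.inr (pos_iff_ne_zero.2 (h hi))
    · exact Or.inl hi
  exact hab.not_ge (Cardinal.Real.Ioo_countable_iff.1 hc)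

/-- There are covers by distinct balls of the same small radius, whose spheres are null and
which coincide with the interior of their closures. -/
lemma exists_generic_cover [CompactSpace M] [MeasurableSpace M] [BorelSpace M]
    (μ : Measure M) [IsFiniteMeasure μ] {e : ℝ} (he : 0 < e) :
    ∃ (N : ℕ) (p : Fin N → M) (ε : ℝ), 0 < ε ∧ ε < e ∧
      (⋃ j, Metric.ball (p j) ε) = univ ∧ (Function.Injective fun j ↦ Metric.ball (p j) ε) ∧
      (∀ j, interior (closure (Metric.ball (p j) ε)) = Metric.ball (p j) ε) ∧
      ∀ j, μ (Metric.sphere (p j) ε) = 0 := by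
  obtain ⟨F, -, hFfin, hF⟩ :=
    finite_cover_balls_of_compact (isCompact_univ (X := M)) (half_pos he)
  obtain ⟨ε, hε, hgen⟩ := exists_generic_radius μ hFfin (half_lt_self he)
  -- Different centres may define the same ball; one centre is kept for each.
  obtain ⟨F', hF', hbij⟩ := exists_subset_bijOn F fun q ↦ Metric.ball q ε
  obtain ⟨N, p, hp, hrange⟩ := (hFfin.subset hF').fin_param
  have hpF : ∀ j, p j ∈ F' := fun j ↦ hrange ▸ mem_range_self j
  refine ⟨N, p, ε, (half_pos he).trans hε.1, hε.2, eq_univ_of_forall fun x ↦ ?_,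
    fun i j hij ↦ hp (hbij.injOn (hpF i) (hpF j) hij), fun j ↦ ?_, fun j ↦ (hgen _ (hF' (hpF j))).2⟩
  · obtain ⟨q, hq, hxq⟩ := mem_iUnion₂.1 (hF (mem_univ x))
    obtain ⟨q', hq', heq⟩ := hbij.surjOn (mem_image_of_mem _ hq)
    obtain ⟨j, rfl⟩ : q' ∈ range p := hrange ▸ hq'
    refine mem_iUnion.2 ⟨j, ?_⟩
    have : x ∈ Metric.ball q ε := Metric.ball_subset_ball hε.1.le hxq
    rwa [← heq] at this
  · refine Subset.antisymm ?_ (interior_maximal subset_closure Metric.isOpen_ball)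
    exact (interior_mono Metric.closure_ball_subset_closedBall).trans (hgen _ (hF' (hpF j))).1

end Generic

/-! ### Pieces: closed dynamical balls mapped onto balls -/

section Pieces

open MeasureTheory MeasureTheory.Measure

variable {d : ℕ} {M : Type*} [MetricSpace M] [ChartedSpace (EuclideanSpace ℝ (Fin d)) M]
  [IsManifold (𝓡 d) ∞ M] [RiemannianBundle (fun x : M ↦ TangentSpace (𝓡 d) x)]
  {Γ : Set (M → M)}

lemma shadows_of_forall_mem {k : ℕ} {f : Fin k → M → M} {V : Fin k → Set M} {s : ℝ} (hs : 0 < s)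
    {w : List (Fin k)} {x : M} (h : ∀ (j : ℕ) (hj : j < w.length), wordMap f (w.take j) x ∈ V w[j]) :
    Shadows f V s w x := by
  induction w generalizing x with
  | nil => trivial
  | cons i w ih =>
    refine ⟨Metric.self_subset_thickening hs _ (h 0 (by simp)), ih fun j hj ↦ ?_⟩
    exact h (j + 1) (by simpa using hj)

namespace ExpandingCover

lemma Admissible.shadows {D : ExpandingCover d Γ} {w : List (Fin D.k)} {x : M}
    (h : D.Admissible w x) {s : ℝ} (hs : 0 < s) : Shadows D.f D.V s w x :=
  shadows_of_forall_mem hs h.2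

lemma exists_admissible (D : ExpandingCover d Γ) (n : ℕ) (x : M) :
    ∃ w, w.length = n + 1 ∧ D.Admissible w x := by
  suffices h : ∀ (n : ℕ) (x : M), ∃ w : List (Fin D.k), w.length = n ∧
      ∀ (j : ℕ) (hj : j < w.length), wordMap D.f (w.take j) x ∈ D.V w[j] by
    obtain ⟨w, hw, hwx⟩ := h (n + 1) x
    exact ⟨w, hw, by rintro rfl; simp at hw, hwx⟩
  intro n
  induction n with
  | zero => exact fun x ↦ ⟨[], rfl, fun j hj ↦ absurd hj (by simp)⟩
  | succ n ih =>
    intro x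
    obtain ⟨i, hi⟩ := mem_iUnion.1 (D.cover.symm ▸ mem_univ x : x ∈ ⋃ i, D.V i)
    obtain ⟨w, hw, hwx⟩ := ih (D.f i x)
    refine ⟨i :: w, by simp [hw], ?_⟩
    rintro (_ | j) hj
    · exact hi
    · exact hwx j (by simpa using hj)

/-- `P` is a closed dynamical ball along `w` whose interior is mapped onto `B(p, ε)`. -/
structure IsPiece (D : ExpandingCover d Γ) (p : M) (ε : ℝ) (w : List (Fin D.k)) (P : Set M) :
    Prop where
  isClosedDynBall : D.IsClosedDynBall p ε w P
  image_interior : wordMap D.f w '' interior P = Metric.ball p ε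
  eq_closure : P = closure (interior P)

variable {D : ExpandingCover d Γ} {α : ℝ≥0} {c : Fin D.k → M → ℝ} {σ : ℝ≥0} {ε ρ : ℝ}
  {w : List (Fin D.k)} {p x : M}

lemma IsPiece.isClosed {P : Set M} (h : D.IsPiece p ε w P) : IsClosed P := by
  rw [h.eq_closure]; exact isClosed_closure

lemma IsPiece.interior_nonempty {P : Set M} (hε : 0 < ε) (h : D.IsPiece p ε w P) :
    (interior P).Nonempty := by
  have : (wordMap D.f w '' interior P).Nonempty := by
    rw [h.image_interior]; exact ⟨p, Metric.mem_ball_self hε⟩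
  exact this.of_image

variable [IsRiemannianManifold (𝓡 d) M]
  [IsContMDiffRiemannianBundle (𝓡 d) ∞ (EuclideanSpace ℝ (Fin d))
    (fun x : M ↦ TangentSpace (𝓡 d) x)] [CompactSpace M]

/-- Pulling back a ball along an admissible word produces a piece. -/
lemma exists_isPiece (hE : ExpandingMaps d α D.f c D.V σ D.r) (hadm : D.Admissible w x)
    (hρ0 : 0 < ρ) (hρ : ρ < D.η) (hε : 0 < ε) (hεη : ε ≤ D.η / 6)
    (hsub : Metric.ball p ε ⊆ Metric.ball (wordMap D.f w x) ρ)
    (hint : interior (closure (Metric.ball p ε)) = Metric.ball p ε) :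
    ∃ y ∈ dynBall D.f x w ρ, wordMap D.f w y = p ∧ Shadows D.f D.V D.η w y ∧
      dynBall D.f y w ε ⊆ dynBall D.f x w ρ ∧
      D.IsPiece p ε w (closure (dynBall D.f y w ε)) := by
  have hη := D.η_lt
  have hη0 := D.η_pos
  -- The orbit of `x` lies in the sets `V` themselves, so any positive tolerance is available; `η -
  -- ρ` leaves tolerance `η` for `y`, and `η + 2 * ε ≤ 4 * η / 3 < r`.
  have hx : Shadows D.f D.V (D.η - ρ) w x := hadm.shadows (by linarith)
  have himg := hE.image_dynBall (ε := ρ) (by linarith) hx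
  obtain ⟨y, hy, hyp⟩ : p ∈ wordMap D.f w '' dynBall D.f x w ρ := by
    rw [himg]; exact hsub (Metric.mem_ball_self hε)
  have hyS : Shadows D.f D.V D.η w y := by simpa using hx.of_mem_dynBall hy
  have hint' := hE.interior_closure_dynBall (w := w) (y := y) hε (by linarith) hyS
    (by rw [hyp]; exact hint)
  have himg' := hE.image_dynBall (ε := ε) (by linarith) hyS
  rw [hyp] at himg'
  refine ⟨y, hy, hyp, hyS, fun z hz ↦ ?_, ⟨x, ρ, y, hadm, hρ0, hρ, hsub, hy, hyp, rfl⟩, ?_, ?_⟩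
  · have h1 : wordMap D.f w z ∈ Metric.ball p ε := himg' ▸ mem_image_of_mem _ hz
    obtain ⟨z', hz', heq⟩ : wordMap D.f w z ∈ wordMap D.f w '' dynBall D.f x w ρ := by
      rw [himg]; exact hsub h1
    have h2 : z' = z := hE.eq_of_wordMap_eq ((hx.of_mem_dynBall hz').mono (by linarith))
      ((hyS.of_mem_dynBall hz).mono (by linarith)) heq
    exact h2 ▸ hz'
  · rw [hint', himg']
  · rw [hint']

/-- By topological mixing, every open set contains pieces over every small ball. -/
lemma TopologicallyMixing.exists_isPiece_subset (hmix : D.TopologicallyMixing)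
    (hE : ExpandingMaps d α D.f c D.V σ D.r) (hε : 0 < ε) (hεη : ε ≤ D.η / 6)
    (hint : interior (closure (Metric.ball p ε)) = Metric.ball p ε)
    {U : Set M} (hU : IsOpen U) (hUne : U.Nonempty) : ∃ w P, D.IsPiece p ε w P ∧ P ⊆ U := by
  have hη0 := D.η_pos
  obtain ⟨x₀, hx₀⟩ := hUne
  obtain ⟨ρ₀, hρ₀, hρU⟩ := Metric.nhds_basis_closedBall.mem_iff.1 (hU.mem_nhds hx₀)
  -- Mixing is applied to a ball whose closed version lies in `U`, because the piece is the closure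
  -- of the dynamical ball; `η / 8` keeps its diameter admissible.
  have hm : 0 < min ρ₀ (D.η / 8) := lt_min hρ₀ (by linarith)
  have hdiam : ∀ (q : M) (t : ℝ), 0 ≤ t → t ≤ D.η / 6 → Metric.diam (Metric.ball q t) < D.η / 2 :=
    fun q t ht0 ht ↦ (Metric.diam_ball ht0).trans_lt (by linarith)
  obtain ⟨x, w, ρ, hadm, hρ0, hρ, hV, hdyn⟩ := hmix (Metric.ball x₀ (min ρ₀ (D.η / 8)))
    (Metric.ball p ε) Metric.isOpen_ball Metric.isOpen_ball ⟨x₀, Metric.mem_ball_self hm⟩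
    ⟨p, Metric.mem_ball_self hε⟩
    (hdiam _ _ hm.le ((min_le_right _ _).trans (by linarith))) (hdiam _ _ hε.le hεη)
  obtain ⟨y, -, -, -, hsub, hP⟩ := exists_isPiece hE hadm hρ0 hρ hε hεη hV hint
  refine ⟨w, _, hP, (closure_mono (hsub.trans hdyn)).trans ?_⟩
  exact (Metric.closure_ball_subset_closedBall.trans
    (Metric.closedBall_subset_closedBall (min_le_left _ _))).trans hρU

/-- Every point lies in arbitrarily small pieces of bounded eccentricity. -/
lemma exists_small_isPiece [MeasurableSpace M] [BorelSpace M]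
    (hE : ExpandingMaps d α D.f c D.V σ D.r) {K R : ℝ} (hK : 1 ≤ K)
    (hdist : ∀ (s ε : ℝ) (w : List (Fin D.k)) (y z : M), ε ≤ R → s + ε ≤ D.r →
      Shadows D.f D.V s w y → z ∈ dynBall D.f y w ε →
      wordFactor D.f c w y ≤ K * wordFactor D.f c w z ∧
      wordFactor D.f c w z ≤ K * wordFactor D.f c w y)
    (hε : 0 < ε) (hεη : ε ≤ D.η / 6) (hεR : 2 * ε ≤ R) {N : ℕ} {p : Fin N → M}
    (hcover : (⋃ j, Metric.ball (p j) ε) = univ)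
    (hint : ∀ j, interior (closure (Metric.ball (p j) ε)) = Metric.ball (p j) ε) :
    ∃ C : ℝ≥0, ∀ x : M, ∀ e > 0, ∃ (j : Fin N) (w : List (Fin D.k)) (P : Set M) (t : ℝ), t ≤ e ∧
      D.IsPiece (p j) ε w P ∧ P ⊆ Metric.closedBall x t ∧
      μH[d] (Metric.closedBall x (3 * t)) ≤ C * μH[d] P := by
  have hη := D.η_lt
  have hη0 := D.η_pos
  have hK0 : 0 < K := one_pos.trans_le hK
  -- With inner radius `q'` and outer radius `q = K ^ 2 * q'` around `y`, and `x` within `q` of `y`,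
  -- the ball of radius `3 * (2 * q)` around `x` lies in that of radius `7 * q` around `y`.
  obtain ⟨C, R₀, hR₀, hdbl⟩ := exists_doubling (d := d) (M := M) (T := 7 * K ^ 2) (by positivity)
  refine ⟨C, fun x e he ↦ ?_⟩
  obtain ⟨n, hn⟩ := exists_pow_lt_of_lt_one
    (show 0 < min (e / 2) R₀ / (K * ε) from div_pos (lt_min (half_pos he) hR₀) (by positivity))
    (show (σ : ℝ) < 1 by exact_mod_cast hE.σ_lt_one)
  obtain ⟨w, hw, hadm⟩ := D.exists_admissible n x
  obtain ⟨j, hj⟩ := mem_iUnion.1 (hcover.symm ▸ mem_univ (wordMap D.f w x) :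
    wordMap D.f w x ∈ ⋃ j, Metric.ball (p j) ε)
  have hsub : Metric.ball (p j) ε ⊆ Metric.ball (wordMap D.f w x) (2 * ε) := by
    intro z hz
    rw [Metric.mem_ball] at hz hj ⊢
    linarith [dist_triangle_right z (wordMap D.f w x) (p j)]
  obtain ⟨y, hy, hyp, hyS, -, hP⟩ := exists_isPiece hE hadm (by positivity) (by linarith) hε hεη
    hsub (hint j)
  -- The point of the dynamical ball above `f_w(x)` is `x` itself, by uniqueness of shadowed
  -- preimages.
  have hxy : x ∈ dynBall D.f y w ε := by
    obtain ⟨z, hz, heq⟩ : wordMap D.f w x ∈ wordMap D.f w '' dynBall D.f y w ε := by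
      rw [hE.image_dynBall (by linarith) hyS, hyp]; exact hj
    have := hE.eq_of_wordMap_eq ((hyS.of_mem_dynBall hz).mono (by linarith))
      (hadm.shadows D.r_pos) heq
    exact this ▸ hz
  obtain ⟨hout, hin⟩ := hE.dynBall_eccentricity hK hε (by linarith) hyS
    fun z hz ↦ hdist _ _ w y z hεR (by linarith) hyS hz
  have hcw := (hE.conformal_wordMap w).pos y
  set q := K * ε / wordFactor D.f c w y with hq
  set q' := ε / (K * wordFactor D.f c w y) with hq'
  have hq0 : 0 < q := by positivity
  have hq'0 : 0 < q' := by positivity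
  have hqq : q = K ^ 2 * q' := by rw [hq, hq']; field_simp
  have hq'q : q' ≤ q := by
    rw [hqq]; exact le_mul_of_one_le_left hq'0.le (one_le_pow₀ hK)
  have hqs : q < min (e / 2) R₀ := by
    have h1 := hE.one_le_pow_mul_wordFactor (hyS.mono (by linarith : D.η ≤ D.r))
    rw [hw] at h1
    rw [lt_div_iff₀ (by positivity)] at hn
    have h2 : (σ : ℝ) ^ (n + 1) ≤ (σ : ℝ) ^ n :=
      pow_le_pow_of_le_one σ.coe_nonneg (by exact_mod_cast hE.σ_lt_one.le) (Nat.le_succ n)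
    refine lt_of_le_of_lt ?_ hn
    rw [hq, div_le_iff₀ hcw]
    have h3 : 1 ≤ (σ : ℝ) ^ n * wordFactor D.f c w y := h1.trans (by gcongr)
    calc K * ε = K * ε * 1 := by ring
      _ ≤ K * ε * ((σ : ℝ) ^ n * wordFactor D.f c w y) := by gcongr
      _ = _ := by ring
  have hqe := hqs.trans_le (min_le_left _ _)
  have hqR := hqs.trans_le (min_le_right _ _)
  have hyx : dist x y ≤ q := Metric.mem_closedBall.1 (hout (subset_closure hxy))
  refine ⟨j, w, _, 2 * q, by linarith, hP, fun z hz ↦ ?_, ?_⟩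
  · have := Metric.mem_closedBall.1 (hout hz)
    rw [Metric.mem_closedBall]
    linarith [dist_triangle_right z x y]
  · calc μH[d] (Metric.closedBall x (3 * (2 * q)))
        ≤ μH[d] (Metric.closedBall y (7 * K ^ 2 * q')) := by
          refine measure_mono fun z hz ↦ ?_
          rw [Metric.mem_closedBall] at hz ⊢
          have : 7 * K ^ 2 * q' = 7 * q := by rw [hqq]; ring
          linarith [dist_triangle z x y]
      _ ≤ C * μH[d] (Metric.ball y q') :=
          hdbl y y q' hq'0 (hq'q.trans_lt hqR) (by simpa using hq'0.le)
      _ ≤ _ := by gcongr; exact hin.trans subset_closure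

end ExpandingCover

end Pieces

/-! ### Sets adapted to a cover by balls -/

section Adapted

variable {M : Type*} [MetricSpace M] {N : ℕ} {p : Fin N → M} {ε : ℝ} {A B : Set M} {x : M}

/-- `A` lies in some ball of the cover, and each ball of the cover contains `A` or is disjoint
from it. -/
def Adapted (p : Fin N → M) (ε : ℝ) (A : Set M) : Prop :=
  (∃ j, A ⊆ Metric.ball (p j) ε) ∧
    ∀ j, A ⊆ Metric.ball (p j) ε ∨ Disjoint A (Metric.ball (p j) ε)

lemma Adapted.mono (h : Adapted p ε B) (hAB : A ⊆ B) : Adapted p ε A :=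
  ⟨h.1.imp fun _ hj ↦ hAB.trans hj, fun j ↦ (h.2 j).imp hAB.trans (Disjoint.mono_left hAB)⟩

/-- Off the spheres, a point lies either in a ball or in the open complement of its closed ball;
finitely many such conditions are open. -/
lemma exists_isOpen_adapted (hcover : (⋃ j, Metric.ball (p j) ε) = univ)
    (hx : x ∉ ⋃ j, Metric.sphere (p j) ε) : ∃ G, IsOpen G ∧ x ∈ G ∧ Adapted p ε G := by
  have hj : ∀ j, ∃ G, IsOpen G ∧ x ∈ G ∧ (x ∈ Metric.ball (p j) ε → G ⊆ Metric.ball (p j) ε) ∧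
      (G ⊆ Metric.ball (p j) ε ∨ Disjoint G (Metric.ball (p j) ε)) := by
    intro j
    by_cases h : x ∈ Metric.ball (p j) ε
    · exact ⟨_, Metric.isOpen_ball, h, fun _ ↦ Subset.rfl, Or.inl Subset.rfl⟩
    · refine ⟨(Metric.closedBall (p j) ε)ᶜ, Metric.isClosed_closedBall.isOpen_compl, fun h' ↦ ?_,
        fun h' ↦ absurd h' h, Or.inr ?_⟩
      · rw [← Metric.ball_union_sphere] at h'
        exact h'.elim h fun hs ↦ hx (mem_iUnion.2 ⟨j, hs⟩)
      · exact (disjoint_compl_left_iff_subset.2 Metric.ball_subset_closedBall)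
  choose G hGo hxG hGx hG using hj
  obtain ⟨i, hi⟩ := mem_iUnion.1 (hcover.symm ▸ mem_univ x : x ∈ ⋃ j, Metric.ball (p j) ε)
  exact ⟨⋂ j, G j, isOpen_iInter_of_finite hGo, mem_iInter.2 hxG,
    ⟨i, (iInter_subset _ i).trans (hGx i hi)⟩,
    fun j ↦ (hG j).imp (iInter_subset _ j).trans (Disjoint.mono_left (iInter_subset _ j))⟩

end Adapted

lemma exists_injective_forall_mem {X : Type*} {N : ℕ} {S : Fin N → Set X}
    (hS : ∀ j, (S j).Infinite) : ∃ q : Fin N → X, Function.Injective q ∧ ∀ j, q j ∈ S j := by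
  induction N with
  | zero => exact ⟨Fin.elim0, fun i ↦ i.elim0, fun i ↦ i.elim0⟩
  | succ N ih =>
    obtain ⟨q, hq, hqS⟩ := ih fun j ↦ hS j.succ
    obtain ⟨x, hx, hxq⟩ := ((hS 0).sdiff (finite_range q)).nonempty
    exact ⟨Fin.cons x q, Fin.cons_injective_iff.2 ⟨hxq, hq⟩, Fin.cases hx hqS⟩

lemma IsLebesgueNull.mono {d : ℕ} {M : Type*} [MetricSpace M]
    [ChartedSpace (EuclideanSpace ℝ (Fin d)) M] {A B : Set M} (h : IsLebesgueNull d B)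
    (hAB : A ⊆ B) : IsLebesgueNull d A :=
  fun x ↦ MeasureTheory.measure_mono_null (image_mono (inter_subset_inter_left _ hAB)) (h x)

/-! ### The semigroup -/

section Semigroup

variable {d : ℕ} {M : Type*} [MetricSpace M] [ChartedSpace (EuclideanSpace ℝ (Fin d)) M]
  [IsManifold (𝓡 d) ∞ M] [RiemannianBundle (fun x : M ↦ TangentSpace (𝓡 d) x)]

/-- In dimension `0` all operator norms vanish, and the convention `0⁻¹ = 0` contradicts expansion.
-/
lemma LocallyExpanding.dim_pos [Nonempty M] {Γ : Set (M → M)} (h : LocallyExpanding d Γ) :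
    0 < d := by
  by_contra! hd
  obtain rfl : d = 0 := Nat.le_zero.1 hd
  obtain ⟨x⟩ := ‹Nonempty M›
  obtain ⟨f, -, hf⟩ := h x
  have : Subsingleton (TangentSpace (𝓡 0) (f x)) :=
    inferInstanceAs (Subsingleton (EuclideanSpace ℝ (Fin 0)))
  have h0 : invDerivNorm 0 f x ≤ 0 :=
    ContinuousLinearMap.opNorm_le_bound _ le_rfl fun v ↦ by
      rw [Subsingleton.elim v 0, map_zero, norm_zero, norm_zero, mul_zero]
  linarith [inv_nonpos.2 h0]

lemma wordMap_mem_semigroupGenerated {X : Type*} {m k : ℕ} {g : Fin m → X → X}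
    {f : Fin k → X → X} (hf : ∀ i, f i ∈ semigroupGenerated g) (w : List (Fin k)) :
    wordMap f w ∈ semigroupGenerated g := by
  induction w with
  | nil => exact ⟨[], rfl⟩
  | cons i w ih =>
    obtain ⟨v, hv⟩ := hf i
    obtain ⟨v', hv'⟩ := ih
    exact ⟨v ++ v', by rw [wordMap_append, wordMap, hv, hv']⟩

/-- The maps of an expanding cover of a semigroup of conformal maps. -/
lemma ExpandingCover.exists_expandingMaps [IsRiemannianManifold (𝓡 d) M]
    [IsContMDiffRiemannianBundle (𝓡 d) ∞ (EuclideanSpace ℝ (Fin d))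
      (fun x : M ↦ TangentSpace (𝓡 d) x)] [Nonempty M] {m : ℕ} {g : Fin m → M → M} {α : ℝ≥0}
    (hd : 0 < d) (hg : ∀ i, ∃ c, IsHolderConformal d α (g i) c)
    (D : ExpandingCover d (semigroupGenerated g)) :
    ∃ (c : Fin D.k → M → ℝ) (σ : ℝ≥0), ExpandingMaps d α D.f c D.V σ D.r := by
  choose c hc using hg
  have hf : ∀ i, ∃ c', IsHolderConformal d α (D.f i) c' := fun i ↦ by
    obtain ⟨w, hw⟩ := D.f_mem i
    exact ⟨_, hw ▸ isHolderConformal_wordMap hc w⟩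
  choose c' hc' using hf
  obtain ⟨x⟩ := ‹Nonempty M›
  obtain ⟨i, hi⟩ := mem_iUnion.1 (D.cover.symm ▸ mem_univ x : x ∈ ⋃ i, D.V i)
  -- Positivity of `σ` is forced by a norm being smaller than it at some point.
  have hσ : 0 < D.σ := (ContinuousLinearMap.opNorm_nonneg _).trans_lt
    (D.expanding i x (Metric.self_subset_thickening D.r_pos _ hi))
  exact ⟨c', ⟨D.σ, hσ.le⟩, hc', D.σ_lt_one, D.injOn,
    fun i x hx ↦ ((hc' i).one_lt_mul hd (D.expanding i x hx)).le⟩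

end Semigroup

/-! ### Families of pieces -/

section Families

open MeasureTheory MeasureTheory.Measure

variable {d : ℕ} {M : Type*} [MetricSpace M] [ChartedSpace (EuclideanSpace ℝ (Fin d)) M]
  [IsManifold (𝓡 d) ∞ M] [RiemannianBundle (fun x : M ↦ TangentSpace (𝓡 d) x)]
  {Γ : Set (M → M)}

namespace ExpandingCover

/-- Disjoint adapted pieces that cover `M` up to a null set and contain a cycle through all balls
of the cover. -/
structure IsPieceFamily (D : ExpandingCover d Γ) {N : ℕ} (p : Fin N → M) (ε : ℝ) {ι : Type*}
    (j : ι → Fin N) (w : ι → List (Fin D.k)) (P : ι → Set M) (b : Fin N → ι) : Prop where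
  countable : Countable ι
  isPiece : ∀ i, D.IsPiece (p (j i)) ε (w i) (P i)
  adapted : ∀ i, Adapted p ε (P i)
  disjoint : ∀ i i', i ≠ i' → Disjoint (P i) (P i')
  null_compl : IsLebesgueNull d (univ \ ⋃ i, P i)
  index_cycle : ∀ t, j (b t) = finRotate N t
  subset_ball : ∀ t, P (b t) ⊆ Metric.ball (p t) ε

namespace IsPieceFamily

variable {D : ExpandingCover d Γ} {N : ℕ} {p : Fin N → M} {ε : ℝ} {ι : Type*} {j : ι → Fin N}
  {w : ι → List (Fin D.k)} {P : ι → Set M} {b : Fin N → ι}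

lemma ball_subset_image (h : D.IsPieceFamily p ε j w P b) (i : ι) :
    Metric.ball (p (j i)) ε ⊆ wordMap D.f (w i) '' P i := by
  rw [← (h.isPiece i).image_interior]
  exact image_mono interior_subset

/-- Markov property: if `h_i` sends a point of `int P_i` into `int P_{i'}`, then `P_{i'}` meets the
ball `h_i(int P_i)`, so adaptedness puts it inside. -/
lemma isMarkovPartition (h : D.IsPieceFamily p ε j w P b) (hε : 0 < ε)
    (hΓ : ∀ w, wordMap D.f w ∈ Γ) : IsMarkovPartition d Γ P fun i ↦ wordMap D.f (w i) where
  countable := h.countable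
  mem i := hΓ (w i)
  isClosed i := (h.isPiece i).isClosed
  nonempty i := ((h.isPiece i).interior_nonempty hε).mono interior_subset
  null_compl := h.null_compl
  eq_closure i := (h.isPiece i).eq_closure
  disjoint i i' hne :=
    ((h.disjoint i i' hne).mono interior_subset interior_subset).inter_eq
  markov i i' := by
    rintro ⟨x, hx, hx'⟩
    refine ((h.adapted i').2 (j i)).elim (fun hs ↦ hs.trans (h.ball_subset_image i)) fun hdis ↦ ?_
    refine absurd ?_ (disjoint_left.1 hdis (interior_subset hx'))
    rw [← (h.isPiece i).image_interior]
    exact mem_image_of_mem _ hx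

lemma images_eq (h : D.IsPieceFamily p ε j w P b) :
    images P (fun i ↦ wordMap D.f (w i)) = range fun t ↦ Metric.ball (p t) ε := by
  refine Subset.antisymm ?_ ?_
  · rintro _ ⟨i, rfl⟩
    exact ⟨j i, (h.isPiece i).image_interior.symm⟩
  · rintro _ ⟨t, rfl⟩
    refine ⟨b ((finRotate N).symm t), ?_⟩
    have := (h.isPiece (b ((finRotate N).symm t))).image_interior
    rwa [h.index_cycle, Equiv.apply_symm_apply] at this

lemma finiteImages (h : D.IsPieceFamily p ε j w P b) :
    FiniteImages P fun i ↦ wordMap D.f (w i) := by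
  rw [FiniteImages, h.images_eq]
  refine ⟨finite_range _, ?_⟩
  rintro _ ⟨t, rfl⟩
  exact Metric.isOpen_ball

/-- The cycle pieces serve as the `n_i`: an element inside `B_t` is covered by the image of the
cycle piece preceding `t`, and its own image `B_{j l}` contains the cycle piece `b (j l)`.
Distinctness of the balls makes the number of images equal to `N`. -/
lemma finiteCycle (h : D.IsPieceFamily p ε j w P b)
    (hinj : Function.Injective fun t ↦ Metric.ball (p t) ε) :
    FiniteCycle P fun i ↦ wordMap D.f (w i) := by
  have hN : (images P fun i ↦ wordMap D.f (w i)).ncard = N := by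
    rw [h.images_eq, ← image_univ, ncard_image_of_injective _ hinj, ncard_univ, Nat.card_fin]
  refine ⟨b ∘ Fin.cast hN, fun l ↦ ?_⟩
  obtain ⟨t, ht⟩ := (h.adapted l).1
  refine ⟨Fin.cast hN.symm ((finRotate N).symm t), Fin.cast hN.symm (j l), ?_, ?_⟩
  · have := h.ball_subset_image (b ((finRotate N).symm t))
    rw [h.index_cycle, Equiv.apply_symm_apply] at this
    exact ht.trans this
  · exact (h.subset_ball (j l)).trans (h.ball_subset_image l)

end IsPieceFamily

variable [IsRiemannianManifold (𝓡 d) M]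
  [IsContMDiffRiemannianBundle (𝓡 d) ∞ (EuclideanSpace ℝ (Fin d))
    (fun x : M ↦ TangentSpace (𝓡 d) x)] [CompactSpace M] [MeasurableSpace M] [BorelSpace M]

/-- By topological mixing, there are disjoint pieces forming a cycle through the cover. -/
lemma TopologicallyMixing.exists_cycle {D : ExpandingCover d Γ} (hmix : D.TopologicallyMixing)
    {α : ℝ≥0} {c : Fin D.k → M → ℝ} {σ : ℝ≥0} (hd : 0 < d)
    (hE : ExpandingMaps d α D.f c D.V σ D.r) {N : ℕ} {p : Fin N → M} {ε : ℝ}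
    (hε : 0 < ε) (hεη : ε ≤ D.η / 6) (hcover : (⋃ j, Metric.ball (p j) ε) = univ)
    (hint : ∀ j, interior (closure (Metric.ball (p j) ε)) = Metric.ball (p j) ε)
    (hnull : ∀ j, μH[d] (Metric.sphere (p j) ε) = 0) :
    ∃ (w : Fin N → List (Fin D.k)) (P : Fin N → Set M),
      (∀ t, D.IsPiece (p (finRotate N t)) ε (w t) (P t)) ∧ (∀ t, Adapted p ε (P t)) ∧
      (∀ t t', t ≠ t' → Disjoint (P t) (P t')) ∧ ∀ t, P t ⊆ Metric.ball (p t) ε := by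
  have := nullSingletonClass_hausdorff M (d := d) (by exact_mod_cast hd)
  -- Removing null spheres leaves positive measure, whereas finite sets are null as `d > 0`. Hence
  -- distinct base points exist, and separating them makes the pieces disjoint.
  have hinf : ∀ t, (Metric.ball (p t) ε \ ⋃ j, Metric.sphere (p j) ε).Infinite := by
    refine fun t hfin ↦ (hausdorffMeasure_pos_of_isOpen (d := d) (Metric.isOpen_ball (ε := ε))
      ⟨p t, Metric.mem_ball_self hε⟩).ne' ?_
    rw [← measure_sdiff_null (measure_iUnion_null hnull)]
    exact hfin.measure_zero _
  obtain ⟨q, hq, hqt⟩ := exists_injective_forall_mem hinf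
  obtain ⟨O, hO, hOdis⟩ := (finite_range q).t2_separation
  have hG := fun t ↦ exists_isOpen_adapted hcover (hqt t).2
  choose G hGo hqG hG using hG
  have hpiece : ∀ t, ∃ w P, D.IsPiece (p (finRotate N t)) ε w P ∧
      P ⊆ Metric.ball (p t) ε ∩ (G t ∩ O (q t)) := fun t ↦
    hmix.exists_isPiece_subset hE hε hεη (hint _)
      (Metric.isOpen_ball.inter ((hGo t).inter (hO _).2)) ⟨q t, (hqt t).1, hqG t, (hO _).1⟩
  choose w P hP hPs using hpiece
  refine ⟨w, P, hP, fun t ↦ (hG t).mono fun x hx ↦ (hPs t hx).2.1, fun t t' hne ↦ ?_,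
    fun t x hx ↦ (hPs t hx).1⟩
  exact (hOdis (mem_range_self t) (mem_range_self t') (hq.ne hne)).mono
    (fun x hx ↦ (hPs t hx).2.2) fun x hx ↦ (hPs t' hx).2.2

/-- Vitali's covering theorem completes a cycle of pieces to a family of full measure. -/
lemma TopologicallyMixing.exists_isPieceFamily {D : ExpandingCover d Γ}
    (hmix : D.TopologicallyMixing) {α : ℝ≥0} {c : Fin D.k → M → ℝ} {σ : ℝ≥0} (hd : 0 < d)
    (hE : ExpandingMaps d α D.f c D.V σ D.r) {K R : ℝ} (hK : 1 ≤ K)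
    (hdist : ∀ (s ε : ℝ) (w : List (Fin D.k)) (y z : M), ε ≤ R → s + ε ≤ D.r →
      Shadows D.f D.V s w y → z ∈ dynBall D.f y w ε →
      wordFactor D.f c w y ≤ K * wordFactor D.f c w z ∧
      wordFactor D.f c w z ≤ K * wordFactor D.f c w y)
    {N : ℕ} {p : Fin N → M} {ε : ℝ}
    (hε : 0 < ε) (hεη : ε ≤ D.η / 6) (hεR : 2 * ε ≤ R)
    (hcover : (⋃ j, Metric.ball (p j) ε) = univ)
    (hint : ∀ j, interior (closure (Metric.ball (p j) ε)) = Metric.ball (p j) ε)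
    (hnull : ∀ j, μH[d] (Metric.sphere (p j) ε) = 0) :
    ∃ (ι : Type) (j : ι → Fin N) (w : ι → List (Fin D.k)) (P : ι → Set M) (b : Fin N → ι),
      D.IsPieceFamily p ε j w P b := by
  obtain ⟨w₀, P₀, hP₀, hA₀, hdis₀, hsub₀⟩ :=
    hmix.exists_cycle hd hE hε hεη hcover hint hnull
  obtain ⟨C, hC⟩ := exists_small_isPiece hE hK hdist hε hεη hεR hcover hint
  have := isFiniteMeasure_hausdorffMeasure (d := d) (M := M)
  have hF : IsClosed (⋃ t, P₀ t) := isClosed_iUnion_of_finite fun t ↦ (hP₀ t).isClosed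
  -- Entries: centre and radius of the Vitali ball, index of the image ball, word, piece.
  let T : Set (M × ℝ × Fin N × List (Fin D.k) × Set M) := {a |
    D.IsPiece (p a.2.2.1) ε a.2.2.2.1 a.2.2.2.2 ∧
    a.2.2.2.2 ⊆ Metric.closedBall a.1 a.2.1 ∧
    μH[d] (Metric.closedBall a.1 (3 * a.2.1)) ≤ C * μH[d] a.2.2.2.2 ∧
    Adapted p ε a.2.2.2.2 ∧ Disjoint a.2.2.2.2 (⋃ t, P₀ t)}
  obtain ⟨u, huT, huc, hudis, hunull⟩ := Vitali.exists_disjoint_covering_ae (μH[d] : Measure M)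
    ((⋃ j, Metric.sphere (p j) ε) ∪ ⋃ t, P₀ t)ᶜ T C (fun a ↦ a.2.1) (fun a ↦ a.1)
    (fun a ↦ a.2.2.2.2) (fun a ha ↦ ha.2.1) (fun a ha ↦ ha.2.2.1)
    (fun a ha ↦ ha.1.interior_nonempty hε) (fun a ha ↦ ha.1.isClosed) (by
      intro x hx e he
      rw [compl_union] at hx
      obtain ⟨G, hGo, hxG, hG⟩ := exists_isOpen_adapted hcover hx.1
      obtain ⟨ρ, hρ, hρG⟩ := Metric.nhds_basis_closedBall.mem_iff.1
        ((hGo.inter hF.isOpen_compl).mem_nhds ⟨hxG, hx.2⟩)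
      obtain ⟨j, w, P, t, ht, hP, hPt, hμ⟩ := hC x (min e ρ) (lt_min he hρ)
      have hPG : P ⊆ G ∩ (⋃ t, P₀ t)ᶜ := (hPt.trans (Metric.closedBall_subset_closedBall
        (ht.trans (min_le_right _ _)))).trans hρG
      exact ⟨(x, t, j, w, P), ⟨hP, hPt, hμ, hG.mono fun z hz ↦ (hPG hz).1,
        disjoint_left.2 fun z hz ↦ (hPG hz).2⟩, ht.trans (min_le_left _ _), rfl⟩)
  have := huc.to_subtype
  -- The countable family is reindexed in `Type`, as `M` may live in any universe.
  let a : Shrink.{0} u → M × ℝ × Fin N × List (Fin D.k) × Set M :=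
    fun i ↦ ((equivShrink.{0} u).symm i).1
  have ha : ∀ i, a i ∈ T := fun i ↦ huT ((equivShrink.{0} u).symm i).2
  have hainj : Function.Injective a :=
    Subtype.val_injective.comp (equivShrink.{0} u).symm.injective
  have hdis' : ∀ t i, Disjoint (P₀ t) (a i).2.2.2.2 := fun t i ↦
    ((ha i).2.2.2.2.mono_right (subset_iUnion P₀ t)).symm
  refine ⟨Fin N ⊕ Shrink.{0} u, Sum.elim (finRotate N) fun i ↦ (a i).2.2.1,
    Sum.elim w₀ fun i ↦ (a i).2.2.2.1, Sum.elim P₀ fun i ↦ (a i).2.2.2.2, Sum.inl, ?_⟩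
  refine ⟨?_, ?_, ?_, ?_, ?_, fun t ↦ rfl, hsub₀⟩
  · have : Countable (Shrink.{0} u) := (equivShrink.{0} u).symm.countable_iff.2 inferInstance
    infer_instance
  · exact Sum.rec hP₀ fun i ↦ (ha i).1
  · exact Sum.rec hA₀ fun i ↦ (ha i).2.2.2.1
  · rintro (t | i) (t' | i') hne
    · exact hdis₀ t t' fun h ↦ hne (congrArg _ h)
    · exact hdis' t i'
    · exact (hdis' t' i).symm
    · exact hudis ((equivShrink.{0} u).symm i).2 ((equivShrink.{0} u).symm i').2
        fun h ↦ hne (congrArg _ (hainj h))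
  · refine (isLebesgueNull_of_hausdorffMeasure (measure_union_null hunull
      (measure_iUnion_null hnull))).mono ?_
    rintro x ⟨-, hx⟩
    rw [mem_iUnion, not_exists] at hx
    by_cases hs : x ∈ ⋃ j, Metric.sphere (p j) ε
    · exact Or.inr hs
    · refine Or.inl ⟨?_, fun hxu ↦ ?_⟩
      · rintro (h | h)
        · exact hs h
        · obtain ⟨t, ht⟩ := mem_iUnion.1 h
          exact hx (Sum.inl t) ht
      · obtain ⟨y, hy, hxy⟩ := mem_iUnion₂.1 hxu
        refine hx (Sum.inr (equivShrink.{0} u ⟨y, hy⟩)) ?_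
        simpa [a] using hxy

end ExpandingCover

end Families

end LocExp

end

/-! ### The main theorem. -/

theorem theoremA {d : ℕ} {M : Type*} [MetricSpace M] [CompactSpace M] [ConnectedSpace M]
    [ChartedSpace (EuclideanSpace ℝ (Fin d)) M] [IsManifold (𝓡 d) ∞ M]
    [RiemannianBundle (fun x : M ↦ TangentSpace (𝓡 d) x)]
    [IsContMDiffRiemannianBundle (𝓡 d) ∞ (EuclideanSpace ℝ (Fin d))
      (fun x : M ↦ TangentSpace (𝓡 d) x)]
    [IsRiemannianManifold (𝓡 d) M]
    {m : ℕ} (g : Fin m → M → M) (α : ℝ≥0) (hα₀ : 0 < α) (hα₁ : α ≤ 1)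
    (hsmooth : ∀ i, LocExp.IsC1Holder d α (g i))
    (hdiffeo : ∀ i, IsLocalDiffeomorph (𝓡 d) (𝓡 d) 1 (g i))
    (hconf : ∀ i, LocExp.IsConformal d (g i))
    (hexp : LocExp.LocallyExpanding d (LocExp.semigroupGenerated g))
    (D : LocExp.ExpandingCover d (LocExp.semigroupGenerated g))
    (hmix : D.TopologicallyMixing) (δ : ℝ) (hδ : 0 < δ) :
    ∃ (N : ℕ) (p : Fin N → M) (ε : ℝ), 0 < ε ∧ ε < δ ∧ ε ≤ D.η / 6 ∧
      (⋃ j, Metric.ball (p j) ε) = univ ∧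
      (Function.Injective fun j ↦ Metric.ball (p j) ε) ∧
      ∃ (ι : Type) (P : ι → Set M) (h : ι → M → M),
        LocExp.IsMarkovPartition d (LocExp.semigroupGenerated g) P h ∧
        LocExp.FiniteImages P h ∧
        LocExp.FiniteCycle P h ∧
        (∀ i i', i ≠ i' → Disjoint (P i) (P i')) ∧
        (∀ i, ∃ (j : Fin N) (w : List (Fin D.k)),
          D.IsClosedDynBall (p j) ε w (P i) ∧ h i = LocExp.wordMap D.f w ∧
          h i '' interior (P i) = Metric.ball (p j) ε) ∧
        (∀ i, ∃ j : Fin N, P i ⊆ Metric.ball (p j) ε) ∧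
        ∃ b : Fin N → ι, ∀ j : Fin N, P (b j) ⊆ Metric.ball (p j) ε ∧
          h (b j) '' interior (P (b j)) = Metric.ball (p (finRotate N j)) ε := by
  let _ : MeasurableSpace M := borel M
  have : BorelSpace M := ⟨rfl⟩
  have hd := hexp.dim_pos
  obtain ⟨c, σ, hE⟩ := D.exists_expandingMaps hd
    fun i ↦ LocExp.IsHolderConformal.of_isConformal hα₀ hα₁ hd (hsmooth i) (hdiffeo i) (hconf i)
  obtain ⟨K, hK, R, hR, hdist⟩ := hE.exists_distortion hα₀
  have := LocExp.isFiniteMeasure_hausdorffMeasure (d := d) (M := M)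
  have hη := D.η_pos
  obtain ⟨N, p, ε, hε, hεe, hcover, hinj, hint, hnull⟩ :=
    LocExp.exists_generic_cover (MeasureTheory.Measure.hausdorffMeasure (X := M) d)
      -- `η / 6` leaves room for pulling balls back; `R / 2` gives bounded distortion on the
      -- dynamical balls of radius `2 * ε`.
      (show 0 < min δ (min (D.η / 6) (R / 2)) by positivity)
  obtain ⟨hεδ, hεη, hεR⟩ : ε < δ ∧ ε < D.η / 6 ∧ ε < R / 2 := by
    simpa only [lt_min_iff] using hεe
  obtain ⟨ι, j, w, P, b, h⟩ := hmix.exists_isPieceFamily hd hE hK hdist hε hεη.le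
    (by linarith) hcover hint hnull
  refine ⟨N, p, ε, hε, hεδ, hεη.le, hcover, hinj, ι, P, fun i ↦ LocExp.wordMap D.f (w i),
    h.isMarkovPartition hε (LocExp.wordMap_mem_semigroupGenerated D.f_mem), h.finiteImages,
    h.finiteCycle hinj, h.disjoint, fun i ↦ ⟨j i, w i, (h.isPiece i).isClosedDynBall, rfl,
      (h.isPiece i).image_interior⟩, fun i ↦ (h.adapted i).1, b, fun t ↦ ⟨h.subset_ball t, ?_⟩⟩
  have := (h.isPiece (b t)).image_interior
  rwa [h.index_cycle] at this
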